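/- Let $\Omega$ be a $\sigma$-compact topological space with a positive regular Borel measure $\mu$, let $K:\Omega\to\mathbb{C}$ be locally integrable, and let $(A(u))_{u\in\Omega}$ be a $\mu$-measurable commuting family of real self-adjoint $n\times n$ matrices, nonsingular for $\mu$-almost every $u$ with $K(u)\neq 0$, such that $|\det A(u)|^{-1/2}K(u)\in L^1(\Omega,\mu)$. Then $(\mathcal{H}_{K,A}f)(x)=\int_\Omega K(u)f(A(u)x)\,d\mu(u)$ (for a.e. $x\in\mathbb{R}^n$, the integral converging absolutely) defines a bounded operator $\mathcal{H}_{K,A}$ on $L^2(\mathbb{R}^n)=L^2(\mathbb{R}^n;\mathbb{C})$, and there are an orthogonal matrix $C$ and vectors $a(u)=(a_1(u),\dots,a_n(u))\in\mathbb{R}^n$ with $C^{-1}A(u)C=\mathrm{diag}(a_1(u),\dots,a_n(u))$ for all $u\in\Omega$. Fix any such $C$ and $a$, and any enumeration $U_1,\dots,U_{2^n}$ of the open hyperoctants of $\mathbb{R}^n$. For $1\le i,j\le 2^n$ let $\varepsilon(i;j)\in\{-1,1\}^n$ be the unique sign vector with $\varepsilon(i;j)U_i=U_j$ (coordinatewise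 multiplication), let $\Omega_{ij}=\{u\in\Omega:(\mathrm{sgn}\,a_1(u),\dots,\mathrm{sgn}\,a_n(u))=\varepsilon(i;j)\}$, and let $$\Phi(s)=\Big(\int_{\Omega_{ij}}K(u)\prod_{k=1}^n|a_k(u)|^{-1/2-\mathrm{i}s_k}\,d\mu(u)\Big)_{i,j=1}^{2^n},\qquad s\in\mathbb{R}^n,$$ be the matrix symbol. Then $\mathcal{H}_{K,A}$ is invertible (has a bounded inverse on $L^2(\mathbb{R}^n)$) if and only if $\inf_{s\in\mathbb{R}^n}|\det\Phi(s)|>0$. In this case its inverse is unitarily equivalent to the (bounded) operator $M_{\Phi^{-1}}$ of multiplication by $\Phi(s)^{-1}$ in $L^2(\mathbb{R}^n;\mathbb{C}^{2^n})$. -/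

import Mathlib

open MeasureTheory
open scoped Matrix

namespace Hausdorff

/-- The real `n`-dimensional Euclidean space (column vectors). -/
abbrev Rn (n : ℕ) : Type := EuclideanSpace ℝ (Fin n)

/-- The complex Hilbert space `L²(ℝⁿ)`. -/
abbrev L2 (n : ℕ) : Type := Lp ℂ 2 (volume : Measure (Rn n))

/-- The complex Hilbert space `L²(ℝⁿ; ℂᵐ)`, where `ℂᵐ` carries its Euclidean norm. -/
abbrev L2Vec (n m : ℕ) : Type := Lp (EuclideanSpace ℂ (Fin m)) 2 (volume : Measure (Rn n))

/-- The matrix `B` acting on a column vector. -/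
def act {n : ℕ} (B : Matrix (Fin n) (Fin n) ℝ) (x : Rn n) : Rn n :=
  WithLp.toLp 2 (B *ᵥ x.ofLp)

/-- The bounded operator `H` on `L²(ℝⁿ)` is the Hausdorff operator with kernel `K` and matrices
`A`: for every `f`, the integral `∫ K(u) f(A(u)x) dμ(u)` exists for almost every `x`, and
it equals `(H f)(x)` for almost every `x`. At most one `H` has this property. -/
def IsHausdorffOperator {Ω : Type*} [MeasurableSpace Ω] (μ : Measure Ω) {n : ℕ} (K : Ω → ℂ)
    (A : Ω → Matrix (Fin n) (Fin n) ℝ) (H : L2 n →L[ℂ] L2 n) : Prop :=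
  ∀ f : L2 n,
    (∀ᵐ x : Rn n, Integrable (fun u => K u * f (act (A u) x)) μ) ∧
    (∀ᵐ x : Rn n, H f x = ∫ u, K u * f (act (A u) x) ∂μ)

/-- `C` is orthogonal and `C⁻¹ A(u) C = diag(a₁(u), …, aₙ(u))` for every `u`. -/
def IsDiagonalizedBy {Ω : Type*} {n : ℕ} (A : Ω → Matrix (Fin n) (Fin n) ℝ)
    (C : Matrix (Fin n) (Fin n) ℝ) (a : Ω → Fin n → ℝ) : Prop :=
  C ∈ Matrix.orthogonalGroup (Fin n) ℝ ∧ ∀ u, C⁻¹ * A u * C = Matrix.diagonal (a u)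

/-- The open hyperoctant of the points whose coordinates have the signs `σ`. An enumeration
`U₁, …, U_{2ⁿ}` of the open hyperoctants is given by a bijection
`e : Fin (2 ^ n) ≃ (Fin n → ℤˣ)` as `U_j = hyperoctant (e j)`. -/
def hyperoctant {n : ℕ} (σ : Fin n → ℤˣ) : Set (Rn n) :=
  {x | ∀ k, 0 < ((σ k : ℤ) : ℝ) * x k}

/-- Coordinatewise multiplication by signs. -/
def reflect {n : ℕ} (ε : Fin n → ℤˣ) (x : Rn n) : Rn n :=
  WithLp.toLp 2 (fun k => ((ε k : ℤ) : ℝ) * x k)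

/-- The sign vector `ε(i; j)`, see `reflect_image_hyperoctant_iff`. -/
def signChange {n : ℕ} (e : Fin (2 ^ n) ≃ (Fin n → ℤˣ)) (i j : Fin (2 ^ n)) : Fin n → ℤˣ :=
  e i * e j

theorem unit_cases (v : ℤˣ) : ((v : ℤ) : ℝ) = 1 ∨ ((v : ℤ) : ℝ) = -1 := by
  rcases Int.units_eq_one_or v with h | h <;> simp [h]

/-- `ε(i; j)` is the unique sign vector `ε` with `ε U_i = U_j`. -/
theorem reflect_image_hyperoctant_iff {n : ℕ} (e : Fin (2 ^ n) ≃ (Fin n → ℤˣ))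
    (i j : Fin (2 ^ n)) (ε : Fin n → ℤˣ) :
    reflect ε '' hyperoctant (e i) = hyperoctant (e j) ↔ ε = signChange e i j := by
  constructor
  · intro h
    have hx : (WithLp.toLp 2 (fun k => ((e i k : ℤ) : ℝ)) : Rn n) ∈ hyperoctant (e i) := by
      intro k
      rcases unit_cases (e i k) with h | h <;> simp [h]
    have h2 : _ ∈ hyperoctant (e j) := h ▸ Set.mem_image_of_mem (reflect ε) hx
    funext k
    have h3 := h2 k
    simp only [reflect, signChange, Pi.mul_apply] at h3 ⊢
    rcases Int.units_eq_one_or (e i k) with h4 | h4 <;>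
    rcases Int.units_eq_one_or (e j k) with h5 | h5 <;>
    rcases Int.units_eq_one_or (ε k) with h6 | h6 <;>
    simp [h4, h5, h6] at h3 ⊢ <;> norm_num at h3
  · rintro rfl
    ext y
    constructor
    · rintro ⟨x, hx, rfl⟩ k
      have h3 := hx k
      simp only [reflect, signChange, Pi.mul_apply]
      rcases Int.units_eq_one_or (e i k) with h4 | h4 <;>
      rcases Int.units_eq_one_or (e j k) with h5 | h5 <;>
      simp [h4, h5] at h3 ⊢ <;> linarith
    · intro hy
      refine ⟨reflect (signChange e i j) y, fun k => ?_, ?_⟩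
      · have h3 := hy k
        simp only [reflect, signChange, Pi.mul_apply]
        rcases Int.units_eq_one_or (e i k) with h4 | h4 <;>
        rcases Int.units_eq_one_or (e j k) with h5 | h5 <;>
        simp [h4, h5] at h3 ⊢ <;> linarith
      · ext k
        simp only [reflect]
        rcases unit_cases (signChange e i j k) with h | h <;> simp [h]

/-- The set of those `u` for which `(sgn a₁(u), …, sgn aₙ(u)) = ε`. -/
def signSet {Ω : Type*} {n : ℕ} (a : Ω → Fin n → ℝ) (ε : Fin n → ℤˣ) : Set Ω :=
  {u | ∀ k, Real.sign (a u k) = ((ε k : ℤ) : ℝ)}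

/-- `|a|^{-1/2 - is} = ∏ₖ exp ((-1/2 - i sₖ) log |aₖ|)`. -/
noncomputable def absPow {n : ℕ} (a : Fin n → ℝ) (s : Rn n) : ℂ :=
  ∏ k, Complex.exp ((-(1 / 2 : ℂ) - Complex.I * (s k : ℂ)) * (Real.log |a k| : ℂ))

/-- The matrix symbol, with respect to the eigenvalues `a(u)` and the enumeration `e` of
the hyperoctants: its entries are `φᵢⱼ(s) = ∫_{Ωᵢⱼ} K(u) |a(u)|^{-1/2 - is} dμ(u)`. -/
noncomputable def symbol {Ω : Type*} [MeasurableSpace Ω] (μ : Measure Ω) {n : ℕ} (K : Ω → ℂ)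
    (a : Ω → Fin n → ℝ) (e : Fin (2 ^ n) ≃ (Fin n → ℤˣ)) (s : Rn n) :
    Matrix (Fin (2 ^ n)) (Fin (2 ^ n)) ℂ :=
  Matrix.of fun i j => ∫ u in signSet a (signChange e i j), K u * absPow (a u) s ∂μ

/-- The bounded operator `M` on `L²(ℝⁿ; ℂᵐ)` is multiplication by the matrix function `Ψ`. -/
def IsMultiplicationOperator {n m : ℕ} (Ψ : Rn n → Matrix (Fin m) (Fin m) ℂ)
    (M : L2Vec n m →L[ℂ] L2Vec n m) : Prop :=
  ∀ g : L2Vec n m, ∀ᵐ s : Rn n, M g s = WithLp.toLp 2 (Ψ s *ᵥ (g s).ofLp)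

/-- Unitary equivalence of bounded operators on two Hilbert spaces. -/
def UnitarilyEquivalent {E F : Type*} [NormedAddCommGroup E] [InnerProductSpace ℂ E]
    [NormedAddCommGroup F] [InnerProductSpace ℂ F] (S : E →L[ℂ] E) (T : F →L[ℂ] F) : Prop :=
  ∃ V : E ≃ₗᵢ[ℂ] F, ∀ x, V (S x) = T (V x)

end Hausdorff

/-! In a common orthonormal eigenbasis, `f ↦ f ∘ A(u)` scales the coordinates by the eigenvalues
`a_k(u)`. Writing `x_k = σ_k exp(-2π t_k)` on the hyperoctant with signs `σ`, such a scaling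
permutes the hyperoctants by the signs of the eigenvalues and translates `t` by `log|a_k| / 2π`.
With the square root of the Jacobian as a weight, passing to the components on the hyperoctants is a
unitary map from `L²(ℝⁿ)` onto `L²(ℝⁿ; ℂ^{2ⁿ})`. The Fourier transform turns the translation into
the character `|a|^{-is}`, and the weight supplies `|a|^{-1/2}`. The resulting unitary `mellin` thus
carries each `f ↦ f ∘ A(u)` to multiplication by a matrix (`mellin_comp_act`), and integration
against `K` yields the symbol.

The interchange of integrals goes through the weak form `⟨g, Hf⟩ = ∫ K(u) ⟨g, f ∘ A(u)⟩ dμ(u)`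
(`weak_form`), justified by Cauchy–Schwarz and `‖f ∘ A(u)‖ = |det A(u)|^{-1/2} ‖f‖`. It mentions
neither the eigenbasis nor the enumeration, so one operator serves every choice of them, and Fubini
recovers the pointwise integral from it.

It remains to invert multiplication by a bounded continuous matrix function. If the determinant is
bounded away from zero, Cramer's formula bounds the inverse matrices. Conversely, a bounded left
inverse gives a lower bound of the operator; testing on small balls makes it pointwise
(`le_norm_mulVec`), and this bounds the determinant from below (`le_norm_det`). -/

namespace Hausdorff

/-! ### Multiplication by bounded matrix functions -/

theorem norm_toLp_mulVec_le {m : ℕ} {P : Matrix (Fin m) (Fin m) ℂ} {B : ℝ}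
    (hB : ∀ i j, ‖P i j‖ ≤ B) (v : EuclideanSpace ℂ (Fin m)) :
    ‖(WithLp.toLp 2 (P *ᵥ v.ofLp) : EuclideanSpace ℂ (Fin m))‖ ≤ (m * (m * B)) * ‖v‖ := by
  have h1 : ‖(WithLp.toLp 2 (P *ᵥ v.ofLp) : EuclideanSpace ℂ (Fin m))‖ ≤
      ∑ i, ‖(P *ᵥ v.ofLp) i‖ := by
    have := norm_sum_le Finset.univ (fun i => EuclideanSpace.single i ((P *ᵥ v.ofLp) i))
    simp only [PiLp.norm_single] at this
    refine le_trans (le_of_eq ?_) this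
    congr 1
    ext k
    simp [Pi.single_apply]
  refine h1.trans ?_
  calc ∑ i, ‖(P *ᵥ v.ofLp) i‖ ≤ ∑ i : Fin m, ∑ j : Fin m, B * ‖v‖ := by
        refine Finset.sum_le_sum fun i _ => ?_
        rw [Matrix.mulVec, dotProduct]
        refine (norm_sum_le _ _).trans (Finset.sum_le_sum fun j _ => ?_)
        rw [norm_mul]
        exact mul_le_mul (hB i j) (PiLp.norm_apply_le v j) (norm_nonneg _)
          ((norm_nonneg _).trans (hB i j))
    _ = _ := by simp; ring

theorem aestronglyMeasurable_mulVec {α : Type*} [MeasurableSpace α] {ν : Measure α} {m : ℕ}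
    {Ψ : α → Matrix (Fin m) (Fin m) ℂ}
    (hΨ : ∀ i j, AEStronglyMeasurable (fun s => Ψ s i j) ν)
    {g : α → EuclideanSpace ℂ (Fin m)} (hg : AEStronglyMeasurable g ν) :
    AEStronglyMeasurable
      (fun s => (WithLp.toLp 2 (Ψ s *ᵥ (g s).ofLp) : EuclideanSpace ℂ (Fin m))) ν := by
  refine (PiLp.continuous_toLp 2 _).comp_aestronglyMeasurable ?_
  refine (aemeasurable_pi_lambda _ fun i => ?_).aestronglyMeasurable
  simp only [Matrix.mulVec, dotProduct]
  refine Finset.aemeasurable_fun_sum _ fun j _ => (hΨ i j).aemeasurable.mul ?_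
  exact (((continuous_apply j).comp (PiLp.continuous_ofLp 2 _)).comp_aestronglyMeasurable
    hg).aemeasurable

theorem memLp_mulVec {n m : ℕ} {Ψ : Rn n → Matrix (Fin m) (Fin m) ℂ} {B : ℝ}
    (hΨ : ∀ i j, AEStronglyMeasurable (fun s => Ψ s i j) volume)
    (hB : ∀ s i j, ‖Ψ s i j‖ ≤ B) (g : L2Vec n m) :
    MemLp (fun s => (WithLp.toLp 2 (Ψ s *ᵥ (g s).ofLp) : EuclideanSpace ℂ (Fin m))) 2 volume :=
  (Lp.memLp g).of_le_mul
    (aestronglyMeasurable_mulVec hΨ (Lp.aestronglyMeasurable g))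
    (Filter.Eventually.of_forall fun s => norm_toLp_mulVec_le (hB s) (g s))

theorem exists_isMultiplicationOperator {n m : ℕ} {Ψ : Rn n → Matrix (Fin m) (Fin m) ℂ} {B : ℝ}
    (hΨ : ∀ i j, AEStronglyMeasurable (fun s => Ψ s i j) volume)
    (hB : ∀ s i j, ‖Ψ s i j‖ ≤ B) :
    ∃ M : L2Vec n m →L[ℂ] L2Vec n m, IsMultiplicationOperator Ψ M := by
  let T : L2Vec n m →ₗ[ℂ] L2Vec n m :=
    { toFun := fun g => (memLp_mulVec hΨ hB g).toLp _
      map_add' := fun g h => by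
        rw [← MemLp.toLp_add]
        refine MemLp.toLp_congr _ _ ?_
        filter_upwards [Lp.coeFn_add g h] with s hs
        rw [hs]
        simp [Matrix.mulVec_add]
      map_smul' := fun c g => by
        rw [RingHom.id_apply, ← MemLp.toLp_const_smul]
        refine MemLp.toLp_congr _ _ ?_
        filter_upwards [Lp.coeFn_smul c g] with s hs
        rw [hs]
        simp [Matrix.mulVec_smul] }
  refine ⟨T.mkContinuous (m * (m * B)) fun g => ?_, fun g => (memLp_mulVec hΨ hB g).coeFn_toLp⟩
  refine Lp.norm_le_mul_norm_of_ae_le_mul ?_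
  filter_upwards [(memLp_mulVec hΨ hB g).coeFn_toLp] with s hs
  change ‖(memLp_mulVec hΨ hB g).toLp _ s‖ ≤ _
  rw [hs]
  exact norm_toLp_mulVec_le (hB s) (g s)

theorem IsMultiplicationOperator.mul {n m : ℕ} {Ψ₁ Ψ₂ : Rn n → Matrix (Fin m) (Fin m) ℂ}
    {M₁ M₂ : L2Vec n m →L[ℂ] L2Vec n m} (h₁ : IsMultiplicationOperator Ψ₁ M₁)
    (h₂ : IsMultiplicationOperator Ψ₂ M₂) (h : ∀ s, Ψ₁ s * Ψ₂ s = 1) : M₁ * M₂ = 1 := by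
  ext1 g
  refine Lp.ext ?_
  filter_upwards [h₁ (M₂ g), h₂ g] with s hs₁ hs₂
  simp [hs₁, hs₂, h]

/-! ### Fourier transform of translations -/

open FourierTransform SchwartzMap in
theorem fourier_comp_sub_const {n : ℕ} {F : Type*} [NormedAddCommGroup F] [NormedSpace ℂ F]
    [CompleteSpace F] (L : F →L[ℂ] F) (l : Rn n) (φ : 𝓢(Rn n, F)) (ξ : Rn n) :
    𝓕 ((φ.compSubConstCLM ℂ l).postcompCLM L) ξ =
      Complex.exp (-(2 * Real.pi * inner ℝ l ξ : ℝ) * Complex.I) • L (𝓕 φ ξ) := by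
  rw [SchwartzMap.fourier_coe, SchwartzMap.fourier_coe, Real.fourier_eq', Real.fourier_eq',
    ← L.integral_comp_comm, ← integral_smul, ← integral_add_right_eq_self _ l]
  · refine integral_congr_ae (Filter.Eventually.of_forall fun t => ?_)
    simp only [postcompCLM_apply, compSubConstCLM_apply, add_sub_cancel_right, map_smul, smul_smul,
      inner_add_left, ← Complex.exp_add]
    congr 2
    push_cast
    ring
  · have := (Real.fourierIntegral_convergent_iff (μ := (volume : Measure (Rn n))) ξ).2 φ.integrable
    refine this.congr (Filter.Eventually.of_forall fun t => ?_)
    simp only [Real.fourierChar_apply', Circle.smul_def, Circle.coe_exp]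
    congr 2
    push_cast
    ring

-- Both sides are continuous in `f` for the `L²` norm, so it suffices to check Schwartz functions,
-- where the Fourier transform is an integral and the variable can be shifted.
open FourierTransform SchwartzMap in
theorem fourier_translate {n m : ℕ} (P : Matrix (Fin m) (Fin m) ℂ) (l : Rn n) (f g : L2Vec n m)
    (hg : ∀ᵐ t, g t = WithLp.toLp 2 (P *ᵥ (f (t - l)).ofLp)) :
    ∀ᵐ ξ, (𝓕 g) ξ = WithLp.toLp 2
      ((Complex.exp (-(2 * Real.pi * inner ℝ l ξ : ℝ) * Complex.I) • P) *ᵥ ((𝓕 f) ξ).ofLp) := by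
  have hmp : MeasurePreserving (fun t : Rn n => t - l) volume volume :=
    measurePreserving_sub_right _ l
  let L : EuclideanSpace ℂ (Fin m) →L[ℂ] EuclideanSpace ℂ (Fin m) :=
    LinearMap.toContinuousLinearMap (Matrix.toEuclideanLin P)
  have hL : ∀ v, L v = WithLp.toLp 2 (P *ᵥ v.ofLp) := fun v => rfl
  let S : L2Vec n m →L[ℂ] L2Vec n m :=
    (L.compLpL 2 volume).comp
      (Lp.compMeasurePreservingₗᵢ ℂ (fun t : Rn n => t - l) hmp).toContinuousLinearMap
  have hS : ∀ f : L2Vec n m, ∀ᵐ t, S f t = L (f (t - l)) := fun f => by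
    filter_upwards [L.coeFn_compLpL (Lp.compMeasurePreserving _ hmp f),
      Lp.coeFn_compMeasurePreserving f hmp] with t h1 h2
    exact h1.trans (congrArg L h2)
  obtain ⟨E, hE⟩ : ∃ E : L2Vec n m →L[ℂ] L2Vec n m, IsMultiplicationOperator
      (fun ξ => Complex.exp (-(2 * Real.pi * inner ℝ l ξ : ℝ) * Complex.I) • P) E := by
    refine exists_isMultiplicationOperator (B := ∑ i, ∑ j, ‖P i j‖) (fun i j => ?_) fun s i j => ?_
    · simp only [Matrix.smul_apply]
      exact Continuous.aestronglyMeasurable (by fun_prop)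
    · rw [Matrix.smul_apply, norm_smul, ← Complex.ofReal_neg, Complex.norm_exp_ofReal_mul_I, one_mul]
      refine (Finset.single_le_sum (f := fun j => ‖P i j‖) (fun _ _ => norm_nonneg _)
        (Finset.mem_univ j)).trans ?_
      exact Finset.single_le_sum (f := fun i => ∑ j, ‖P i j‖)
        (fun _ _ => Finset.sum_nonneg fun _ _ => norm_nonneg _) (Finset.mem_univ i)
  have key : ∀ f : L2Vec n m, 𝓕 (S f) = E (𝓕 f) := fun f => by
    refine DenseRange.induction_on (p := fun f : L2Vec n m => 𝓕 (S f) = E (𝓕 f))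
      (SchwartzMap.denseRange_toLpCLM (p := 2) ENNReal.ofNat_ne_top) f ?_ fun φ => ?_
    · have hc := (Lp.fourierTransformₗᵢ (Rn n) (EuclideanSpace ℂ (Fin m))).continuous
      exact isClosed_eq (hc.comp S.continuous) (E.continuous.comp hc)
    · have h1 : S (φ.toLp 2) = ((φ.compSubConstCLM ℂ l).postcompCLM L).toLp 2 := by
        refine Lp.ext ?_
        filter_upwards [hS (φ.toLp 2), SchwartzMap.coeFn_toLp
          ((φ.compSubConstCLM ℂ l).postcompCLM L) 2,
          hmp.quasiMeasurePreserving.ae (p := fun x => φ.toLp 2 volume x = φ x)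
            (SchwartzMap.coeFn_toLp φ 2 volume)] with t h1 h2 h3
        rw [h1, h2, h3]
        rfl
      rw [SchwartzMap.toLpCLM_apply, h1, SchwartzMap.toLp_fourier_eq, SchwartzMap.toLp_fourier_eq]
      refine Lp.ext ?_
      filter_upwards [SchwartzMap.coeFn_toLp (𝓕 ((φ.compSubConstCLM ℂ l).postcompCLM L)) 2,
        SchwartzMap.coeFn_toLp (𝓕 φ) 2, hE ((𝓕 φ).toLp 2)] with ξ h1 h2 h3
      rw [h1, h3, h2, fourier_comp_sub_const, hL, Matrix.smul_mulVec, WithLp.toLp_smul]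
  have hgS : g = S f := Lp.ext (by
    filter_upwards [hg, hS f] with t h1 h2
    rw [h1, h2, hL])
  rw [hgS, key]
  exact hE (𝓕 f)

/-! ### Logarithmic coordinates on the hyperoctants -/

theorem continuous_act {n : ℕ} (B : Matrix (Fin n) (Fin n) ℝ) : Continuous (act B) :=
  (PiLp.continuous_toLp 2 _).comp (by fun_prop)

theorem act_act {n : ℕ} (B C : Matrix (Fin n) (Fin n) ℝ) (x : Rn n) :
    act B (act C x) = act (B * C) x := by
  simp [act]

/-- Linear change of variables. -/
theorem lintegral_comp_act {n : ℕ} {B : Matrix (Fin n) (Fin n) ℝ} (hB : B.det ≠ 0)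
    {G : Rn n → ENNReal} (hG : Measurable G) :
    ∫⁻ x, G (act B x) = ENNReal.ofReal |B.det⁻¹| * ∫⁻ x, G x := by
  have h1 := EuclideanSpace.volume_preserving_symm_measurableEquiv_toLp (Fin n)
  have h2 := h1.symm
  have hm : Measurable (fun y : Fin n → ℝ => G (WithLp.toLp 2 y)) :=
    hG.comp (PiLp.continuous_toLp 2 _).measurable
  have e1 : ∫⁻ x, G x = ∫⁻ y : Fin n → ℝ, G (WithLp.toLp 2 y) :=
    (h2.lintegral_comp hG).symm
  have e2 : ∫⁻ x, G (act B x) = ∫⁻ y : Fin n → ℝ, G (WithLp.toLp 2 (Matrix.toLin' B y)) :=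
    (h2.lintegral_comp (hG.comp (continuous_act B).measurable)).symm
  rw [e1, e2, ← lintegral_map (f := fun y : Fin n → ℝ => G (WithLp.toLp 2 y)) hm
    (LinearMap.continuous_of_finiteDimensional (Matrix.toLin' B)).measurable,
    Real.map_matrix_volume_pi_eq_smul_volume_pi hB, lintegral_smul_measure, smul_eq_mul]

/-- The logarithmic coordinates on the hyperoctant with signs `σ`. -/
noncomputable def expPi {n : ℕ} (σ : Fin n → ℤˣ) (t : Fin n → ℝ) : Fin n → ℝ :=
  fun k => ((σ k : ℤ) : ℝ) * Real.exp (-(2 * Real.pi * t k))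

theorem sign_mul_self (v : ℤˣ) : ((v : ℤ) : ℝ) * ((v : ℤ) : ℝ) = 1 := by
  rcases unit_cases v with h | h <;> simp [h]

/-- The map `expPi σ` acts coordinatewise, so its derivative is diagonal and the Jacobian is the
product of the one-variable derivatives. -/
theorem lintegral_expPi {n : ℕ} (σ : Fin n → ℤˣ) (G : (Fin n → ℝ) → ENNReal) :
    ∫⁻ x in {x | ∀ k, 0 < ((σ k : ℤ) : ℝ) * x k}, G x =
      ∫⁻ t, ENNReal.ofReal (∏ k, 2 * Real.pi * Real.exp (-(2 * Real.pi * t k))) *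
        G (expPi σ t) := by
  have hpi := Real.pi_pos
  have himg : expPi σ '' Set.univ = {x | ∀ k, 0 < ((σ k : ℤ) : ℝ) * x k} := by
    ext x
    simp only [Set.image_univ, Set.mem_range, Set.mem_ofPred_eq]
    constructor
    · rintro ⟨t, rfl⟩ k
      rw [expPi, ← mul_assoc, sign_mul_self, one_mul]
      exact Real.exp_pos _
    · intro h
      refine ⟨fun k => -(Real.log (((σ k : ℤ) : ℝ) * x k) / (2 * Real.pi)), funext fun k => ?_⟩
      have : -(2 * Real.pi * -(Real.log (((σ k : ℤ) : ℝ) * x k) / (2 * Real.pi))) =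
          Real.log (((σ k : ℤ) : ℝ) * x k) := by field_simp
      rw [expPi, this, Real.exp_log (h k), ← mul_assoc, sign_mul_self, one_mul]
  have hinj : Set.InjOn (expPi σ) Set.univ := by
    intro t _ t' _ h
    funext k
    have hk := congrFun h k
    simp only [expPi] at hk
    have hne : ((σ k : ℤ) : ℝ) ≠ 0 := left_ne_zero_of_mul_eq_one (sign_mul_self _)
    have := Real.exp_injective (mul_left_cancel₀ hne hk)
    have h2 : (2 * Real.pi) * t k = (2 * Real.pi) * t' k := by linarith
    exact mul_left_cancel₀ (by positivity) h2
  let D : (Fin n → ℝ) → (Fin n → ℝ) →L[ℝ] (Fin n → ℝ) := fun t =>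
    ContinuousLinearMap.pi fun k =>
      ((((σ k : ℤ) : ℝ) * (Real.exp (-(2 * Real.pi * t k)) * -(2 * Real.pi))) •
        ContinuousLinearMap.id ℝ ℝ).comp (ContinuousLinearMap.proj k)
  have hD : ∀ t ∈ Set.univ, HasFDerivWithinAt (expPi σ) (D t) Set.univ t := by
    intro t _
    refine HasFDerivAt.hasFDerivWithinAt (hasFDerivAt_pi.2 fun k => ?_)
    have h1 : HasDerivAt (fun r : ℝ => ((σ k : ℤ) : ℝ) * Real.exp (-(2 * Real.pi * r)))
        (((σ k : ℤ) : ℝ) * (Real.exp (-(2 * Real.pi * t k)) * -(2 * Real.pi))) (t k) := by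
      refine (HasDerivAt.exp ?_).const_mul _
      simpa using (hasDerivAt_id (t k)).const_mul (-(2 * Real.pi))
    have h2 := h1.hasFDerivAt.comp t (hasFDerivAt_apply (𝕜 := ℝ) (F' := fun _ => ℝ) k t)
    refine h2.congr_fderiv ?_
    ext v
    simp [mul_comm]
  have hdet : ∀ t, |(D t).det| = ∏ k, 2 * Real.pi * Real.exp (-(2 * Real.pi * t k)) := by
    intro t
    rw [ContinuousLinearMap.det_pi, Finset.abs_prod]
    refine Finset.prod_congr rfl fun k _ => ?_
    have : |((σ k : ℤ) : ℝ)| = 1 := by rcases unit_cases (σ k) with h | h <;> simp [h]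
    simp [abs_mul, this, abs_of_pos hpi, mul_comm]
  rw [← himg, lintegral_image_eq_lintegral_abs_det_fderiv_mul volume MeasurableSet.univ hD hinj,
    Measure.restrict_univ]
  simp only [hdet]

/-- The open hyperoctants fill the space up to a null set. -/
theorem sum_lintegral_octant {n : ℕ} (G : (Fin n → ℝ) → ENNReal) :
    ∑ σ : Fin n → ℤˣ, ∫⁻ x in {x | ∀ k, 0 < ((σ k : ℤ) : ℝ) * x k}, G x = ∫⁻ x, G x := by
  have hmeas : ∀ σ : Fin n → ℤˣ,
      MeasurableSet {x : Fin n → ℝ | ∀ k, 0 < ((σ k : ℤ) : ℝ) * x k} := fun σ => by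
    simp only [Set.ofPred_forall]
    exact MeasurableSet.iInter fun k => measurableSet_lt measurable_const (by fun_prop)
  have hdisj : Pairwise (Function.onFun Disjoint
      fun σ : Fin n → ℤˣ => {x : Fin n → ℝ | ∀ k, 0 < ((σ k : ℤ) : ℝ) * x k}) := by
    intro σ τ hne
    refine Set.disjoint_left.2 fun x hx hx' => hne (funext fun k => ?_)
    have h1 := hx k
    have h2 := hx' k
    rcases Int.units_eq_one_or (σ k) with h | h <;> rcases Int.units_eq_one_or (τ k) with h' | h' <;>
      simp [h, h'] at h1 h2 ⊢ <;> linarith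
  rw [← tsum_fintype (L := .unconditional _), ← lintegral_iUnion hmeas hdisj]
  have : ∀ᵐ x : Fin n → ℝ, x ∈ ⋃ σ : Fin n → ℤˣ, {x | ∀ k, 0 < ((σ k : ℤ) : ℝ) * x k} := by
    -- The coordinate hyperplanes are null, and a point off them lies in the hyperoctant of its own
    -- signs.
    have h0 : ∀ᵐ x : Fin n → ℝ, ∀ k, x k ≠ 0 :=
      ae_all_iff.2 fun k => compl_mem_ae_iff.2 (Measure.pi_hyperplane _ k 0)
    filter_upwards [h0] with x hx
    refine Set.mem_iUnion.2 ⟨fun k => if 0 < x k then 1 else -1, fun k => ?_⟩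
    rcases lt_or_gt_of_ne (hx k) with h | h
    · simp [h.not_gt, h]
    · simp [h]
  rw [Measure.restrict_eq_self_of_ae_mem this]

/-- Logarithmic coordinates on the image of a hyperoctant under `C`. -/
noncomputable def octMap {n : ℕ} (C : Matrix (Fin n) (Fin n) ℝ) (σ : Fin n → ℤˣ) (t : Rn n) :
    Rn n :=
  act C (WithLp.toLp 2 (expPi σ t.ofLp))

/-- The square root of the Jacobian of the logarithmic coordinates. -/
noncomputable def octWeight {n : ℕ} (t : Rn n) : ℝ :=
  ∏ k, Real.sqrt (2 * Real.pi) * Real.exp (-(Real.pi * t k))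

theorem octWeight_pos {n : ℕ} (t : Rn n) : 0 < octWeight t :=
  Finset.prod_pos fun _ _ => mul_pos (Real.sqrt_pos.2 (by positivity)) (Real.exp_pos _)

theorem octWeight_sq {n : ℕ} (t : Rn n) :
    octWeight t ^ 2 = ∏ k, 2 * Real.pi * Real.exp (-(2 * Real.pi * t k)) := by
  rw [octWeight, ← Finset.prod_pow]
  refine Finset.prod_congr rfl fun k _ => ?_
  rw [mul_pow, Real.sq_sqrt (by positivity), ← Real.exp_nat_mul]
  congr 2
  push_cast
  ring

theorem continuous_octMap {n : ℕ} (C : Matrix (Fin n) (Fin n) ℝ) (σ : Fin n → ℤˣ) :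
    Continuous (octMap C σ) := by
  refine (continuous_act C).comp ((PiLp.continuous_toLp 2 _).comp ?_)
  unfold expPi
  fun_prop

theorem continuous_octWeight {n : ℕ} : Continuous (octWeight (n := n)) := by
  unfold octWeight
  fun_prop

theorem abs_det_orthogonal {n : ℕ} {C : Matrix (Fin n) (Fin n) ℝ}
    (hC : C ∈ Matrix.orthogonalGroup (Fin n) ℝ) : |C.det| = 1 := by
  have h := congrArg Matrix.det ((Matrix.mem_orthogonalGroup_iff (Fin n) ℝ).1 hC)
  rw [Matrix.det_mul, Matrix.det_transpose, Matrix.det_one] at h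
  rw [abs_eq (by norm_num)]
  exact mul_self_eq_one_iff.1 h

theorem sum_lintegral_octMap {n : ℕ} {C : Matrix (Fin n) (Fin n) ℝ}
    (hC : C ∈ Matrix.orthogonalGroup (Fin n) ℝ) {G : Rn n → ENNReal} (hG : Measurable G) :
    ∑ σ : Fin n → ℤˣ, ∫⁻ t, ENNReal.ofReal (octWeight t ^ 2) * G (octMap C σ t) =
      ∫⁻ x, G x := by
  have hdet := abs_det_orthogonal hC
  have h0 : C.det ≠ 0 := by
    intro h
    simp [h] at hdet
  have h1 := lintegral_comp_act h0 hG
  rw [abs_inv, hdet, inv_one, ENNReal.ofReal_one, one_mul] at h1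
  have h2 := (EuclideanSpace.volume_preserving_symm_measurableEquiv_toLp (Fin n)).symm
  have hG' : Measurable fun x => G (act C x) := hG.comp (continuous_act C).measurable
  rw [← h1, ← h2.lintegral_comp hG', ← sum_lintegral_octant]
  refine Finset.sum_congr rfl fun σ _ => ?_
  rw [lintegral_expPi, ← h2.lintegral_comp]
  · simp only [octWeight_sq]
    rfl
  · exact ((continuous_octWeight.pow 2).measurable.ennreal_ofReal).mul
      (hG.comp (continuous_octMap C σ).measurable)

/-- The change of variables, applied to the indicator of a measurable null set, gives a vanishing
integral with a positive weight, so the preimage is null. This makes composition with `octMap`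
meaningful for classes of functions. -/
theorem ae_octMap {n : ℕ} {C : Matrix (Fin n) (Fin n) ℝ}
    (hC : C ∈ Matrix.orthogonalGroup (Fin n) ℝ) (σ : Fin n → ℤˣ) {p : Rn n → Prop}
    (hp : ∀ᵐ x, p x) : ∀ᵐ t, p (octMap C σ t) := by
  obtain ⟨s, hs, hsm, hs0⟩ := exists_measurable_superset_of_null (ae_iff.1 hp)
  have h1 := sum_lintegral_octMap hC (G := s.indicator 1) (measurable_one.indicator hsm)
  rw [lintegral_indicator_one hsm, hs0, Finset.sum_eq_zero_iff] at h1
  have h2 := h1 σ (Finset.mem_univ _)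
  have h3 := (lintegral_eq_zero_iff
    (((continuous_octWeight.pow 2).measurable.ennreal_ofReal).mul
    ((measurable_one.indicator hsm).comp (continuous_octMap C σ).measurable))).1 h2
  filter_upwards [h3] with t ht
  by_contra hpt
  have hmem : octMap C σ t ∈ s := hs hpt
  have hw := octWeight_pos t
  simp [hmem] at ht
  exact absurd ht (by positivity)

/-! ### The unitary passage to components on the hyperoctants -/

theorem eLpNorm_two_sq {α F : Type*} [MeasurableSpace α] [NormedAddCommGroup F] (ν : Measure α)
    (f : α → F) : eLpNorm f 2 ν ^ 2 = ∫⁻ x, ‖f x‖ₑ ^ 2 ∂ν := by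
  have := eLpNorm_nnreal_pow_eq_lintegral (μ := ν) (f := f) (p := 2) two_ne_zero
  simpa using this

theorem enorm_sq_euclidean {m : ℕ} (v : EuclideanSpace ℂ (Fin m)) :
    ‖v‖ₑ ^ 2 = ∑ i, ‖v i‖ₑ ^ 2 := by
  simp only [← ofReal_norm, ← ENNReal.ofReal_pow (norm_nonneg _)]
  rw [EuclideanSpace.norm_sq_eq, ENNReal.ofReal_sum_of_nonneg fun _ _ => by positivity]

/-- The components of a function on the hyperoctants, in logarithmic coordinates. -/
noncomputable def octComponents {n : ℕ} (C : Matrix (Fin n) (Fin n) ℝ)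
    (e : Fin (2 ^ n) ≃ (Fin n → ℤˣ)) (f : Rn n → ℂ) (t : Rn n) :
    EuclideanSpace ℂ (Fin (2 ^ n)) :=
  WithLp.toLp 2 fun i => (octWeight t : ℂ) * f (octMap C (e i) t)

section

variable {n : ℕ} {C : Matrix (Fin n) (Fin n) ℝ}
  (hC : C ∈ Matrix.orthogonalGroup (Fin n) ℝ) (e : Fin (2 ^ n) ≃ (Fin n → ℤˣ))

include hC in
theorem eLpNorm_octComponents {f : Rn n → ℂ} (hf : Measurable f) :
    eLpNorm (octComponents C e f) 2 volume = eLpNorm f 2 volume := by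
  have hmeas : Measurable fun x => ‖f x‖ₑ ^ 2 := hf.enorm.pow_const 2
  have h : eLpNorm (octComponents C e f) 2 volume ^ 2 = eLpNorm f 2 volume ^ 2 := by
    rw [eLpNorm_two_sq, eLpNorm_two_sq, ← sum_lintegral_octMap hC hmeas,
      ← Equiv.sum_comp e, ← lintegral_finsetSum]
    · refine lintegral_congr fun t => ?_
      rw [enorm_sq_euclidean]
      refine Finset.sum_congr rfl fun i _ => ?_
      rw [octComponents, enorm_mul, mul_pow]
      congr 1
      rw [← ofReal_norm, ← ENNReal.ofReal_pow (norm_nonneg _), Complex.norm_real,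
        Real.norm_eq_abs, sq_abs]
    · intro i _
      exact ((continuous_octWeight.pow 2).measurable.ennreal_ofReal).mul
        (hmeas.comp (continuous_octMap C _).measurable)
  exact (ENNReal.pow_right_strictMono two_ne_zero).injective h

theorem aestronglyMeasurable_octComponents {f : Rn n → ℂ} (hf : Measurable f) :
    AEStronglyMeasurable (octComponents C e f) volume := by
  refine (PiLp.continuous_toLp 2 _).comp_aestronglyMeasurable
    (aemeasurable_pi_lambda _ fun i => ?_).aestronglyMeasurable
  exact ((Complex.continuous_ofReal.comp continuous_octWeight).measurable.mul
    (hf.comp (continuous_octMap C _).measurable)).aemeasurable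

include hC in
theorem octComponents_congr {f g : Rn n → ℂ} (h : f =ᵐ[volume] g) :
    octComponents C e f =ᵐ[volume] octComponents C e g := by
  have : ∀ᵐ t, ∀ i, f (octMap C (e i) t) = g (octMap C (e i) t) :=
    ae_all_iff.2 fun i => ae_octMap hC (e i) h
  filter_upwards [this] with t ht
  simp only [octComponents, ht]

include hC in
theorem memLp_octComponents (f : L2 n) : MemLp (octComponents C e f) 2 volume :=
  ⟨aestronglyMeasurable_octComponents e (Lp.stronglyMeasurable f).measurable, by
    rw [eLpNorm_octComponents hC e (Lp.stronglyMeasurable f).measurable]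
    exact Lp.eLpNorm_lt_top f⟩

/-- The passage to components on the hyperoctants as a linear isometry. -/
noncomputable def octIsometry : L2 n →ₗᵢ[ℂ] L2Vec n (2 ^ n) where
  toFun f := (memLp_octComponents hC e f).toLp _
  map_add' f g := by
    rw [← MemLp.toLp_add]
    refine MemLp.toLp_congr _ _ ?_
    filter_upwards [octComponents_congr hC e (Lp.coeFn_add f g)] with t ht
    rw [ht]
    ext i
    simp [octComponents, mul_add]
  map_smul' c f := by
    rw [RingHom.id_apply, ← MemLp.toLp_const_smul]
    refine MemLp.toLp_congr _ _ ?_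
    filter_upwards [octComponents_congr hC e (Lp.coeFn_smul c f)] with t ht
    rw [ht]
    ext i
    simp [octComponents, mul_left_comm]
  norm_map' f := by
    change ‖(memLp_octComponents hC e f).toLp _‖ = _
    rw [Lp.norm_toLp, eLpNorm_octComponents hC e (Lp.stronglyMeasurable f).measurable,
      Lp.norm_def]

theorem octIsometry_ae (f : L2 n) : octIsometry hC e f =ᵐ[volume] octComponents C e f :=
  (memLp_octComponents hC e f).coeFn_toLp

/-- The inverse of the logarithmic coordinates. -/
noncomputable def octLog (C : Matrix (Fin n) (Fin n) ℝ) (x : Rn n) : Rn n :=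
  WithLp.toLp 2 fun k => -(Real.log |act Cᵀ x k| / (2 * Real.pi))

include hC in
theorem act_transpose_octMap (σ : Fin n → ℤˣ) (t : Rn n) :
    act Cᵀ (octMap C σ t) = WithLp.toLp 2 (expPi σ t.ofLp) := by
  rw [octMap, act_act, (Matrix.mem_orthogonalGroup_iff' (Fin n) ℝ).1 hC]
  simp [act]

theorem abs_sign (v : ℤˣ) : |((v : ℤ) : ℝ)| = 1 := by
  rcases unit_cases v with h | h <;> simp [h]

include hC in
theorem octLog_octMap (σ : Fin n → ℤˣ) (t : Rn n) : octLog C (octMap C σ t) = t := by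
  have hpi := Real.pi_pos
  rw [octLog, act_transpose_octMap hC]
  ext k
  simp only [expPi, abs_mul, abs_sign, one_mul, abs_of_pos (Real.exp_pos _), Real.log_exp]
  field_simp

theorem measurable_octLog : Measurable (octLog C) := by
  refine (PiLp.continuous_toLp 2 _).measurable.comp (measurable_pi_lambda _ fun k => ?_)
  have : Measurable fun x : Rn n => act Cᵀ x k :=
    ((continuous_apply k).comp ((PiLp.continuous_ofLp 2 _).comp (continuous_act _))).measurable
  exact ((Real.measurable_log.comp this.abs).div_const _).neg

-- A preimage of `h` is glued from its components: on the image under `C` of the `i`-th hyperoctant,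
-- take `h_i` at the logarithmic coordinates and divide by the weight.
include hC in
theorem octIsometry_surjective : Function.Surjective (octIsometry hC e) := by
  classical
  intro h
  -- As `C` is orthogonal, `O σ` is the image under `C` of the hyperoctant with signs `σ`.
  let O : (Fin n → ℤˣ) → Set (Rn n) := fun σ => {x | ∀ k, 0 < ((σ k : ℤ) : ℝ) * act Cᵀ x k}
  have hO : ∀ σ, MeasurableSet (O σ) := fun σ => by
    simp only [O, Set.ofPred_forall]
    refine MeasurableSet.iInter fun k => measurableSet_lt measurable_const ?_
    exact (continuous_const.mul
      ((continuous_apply k).comp ((PiLp.continuous_ofLp 2 _).comp (continuous_act _)))).measurable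
  have hOmem : ∀ σ τ t, octMap C σ t ∈ O τ ↔ τ = σ := fun σ τ t => by
    simp only [O, Set.mem_ofPred_eq, act_transpose_octMap hC, expPi]
    constructor
    · refine fun hx => funext fun k => ?_
      have h1 := hx k
      have h2 := Real.exp_pos (-(2 * Real.pi * t k))
      rcases Int.units_eq_one_or (σ k) with h | h <;>
        rcases Int.units_eq_one_or (τ k) with h' | h' <;> simp [h, h'] at h1 h2 ⊢ <;> linarith
    · rintro rfl k
      rw [← mul_assoc, sign_mul_self, one_mul]
      exact Real.exp_pos _
  let g : Rn n → ℂ := fun x => ∑ i, (O (e i)).indicator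
    (fun x => h (octLog C x) i / (octWeight (octLog C x) : ℂ)) x
  have hhm : ∀ i, Measurable fun t => h t i := fun i =>
    ((continuous_apply i).comp (PiLp.continuous_ofLp 2 _)).measurable.comp
      (Lp.stronglyMeasurable h).measurable
  have hgm : Measurable g := by
    refine Finset.measurable_fun_sum _ fun i _ => Measurable.indicator ?_ (hO _)
    exact ((hhm i).comp measurable_octLog).div
      ((Complex.continuous_ofReal.comp continuous_octWeight).measurable.comp measurable_octLog)
  have hg : ∀ t, octComponents C e g t = h t := fun t => by
    ext i
    have hne : (octWeight t : ℂ) ≠ 0 := Complex.ofReal_ne_zero.2 (octWeight_pos t).ne'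
    have : g (octMap C (e i) t) = h t i / (octWeight t : ℂ) := by
      simp only [g]
      rw [Finset.sum_eq_single i]
      · rw [Set.indicator_of_mem ((hOmem _ _ _).2 rfl), octLog_octMap hC]
      · intro j _ hj
        exact Set.indicator_of_notMem (fun hm => hj (e.injective ((hOmem _ _ _).1 hm))) _
      · simp
    simp only [octComponents, this]
    field_simp
  have hgLp : MemLp g 2 volume := by
    refine ⟨hgm.aestronglyMeasurable, ?_⟩
    -- The norm identity requires only measurability, so it can be read backwards to show that `g`
    -- is square integrable.
    rw [← eLpNorm_octComponents hC e hgm, funext hg]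
    exact Lp.eLpNorm_lt_top h
  refine ⟨hgLp.toLp g, Lp.ext ?_⟩
  filter_upwards [octIsometry_ae hC e (hgLp.toLp g), octComponents_congr hC e hgLp.coeFn_toLp]
    with t h1 h2
  rw [h1, h2, hg]

end

/-! ### Dilations as matrix multiplications -/

/-- The unitary operator that turns Hausdorff operators into multiplication operators. -/
noncomputable def mellin {n : ℕ} {C : Matrix (Fin n) (Fin n) ℝ}
    (hC : C ∈ Matrix.orthogonalGroup (Fin n) ℝ) (e : Fin (2 ^ n) ≃ (Fin n → ℤˣ)) :
    L2 n ≃ₗᵢ[ℂ] L2Vec n (2 ^ n) :=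
  (LinearIsometryEquiv.ofSurjective (octIsometry hC e) (octIsometry_surjective hC e)).trans
    (Lp.fourierTransformₗᵢ (Rn n) (EuclideanSpace ℂ (Fin (2 ^ n))))

/-- The matrix by which the composition with one matrix with eigenvalues `b` acts after `mellin`. -/
noncomputable def dilationMatrix {n : ℕ} (e : Fin (2 ^ n) ≃ (Fin n → ℤˣ)) (b : Fin n → ℝ)
    (s : Rn n) : Matrix (Fin (2 ^ n)) (Fin (2 ^ n)) ℂ :=
  open Classical in
  Matrix.of fun i j => if ∀ k, Real.sign (b k) = ((signChange e i j k : ℤ) : ℝ) then absPow b s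
    else 0

theorem exists_units_sign {n : ℕ} {b : Fin n → ℝ} (hb : ∀ k, b k ≠ 0) :
    ∃ τ : Fin n → ℤˣ, ∀ k, Real.sign (b k) = ((τ k : ℤ) : ℝ) := by
  refine ⟨fun k => if 0 < b k then 1 else -1, fun k => ?_⟩
  rcases lt_or_gt_of_ne (hb k) with h | h
  · simp [h.not_gt, Real.sign_of_neg h]
  · simp [h, Real.sign_of_pos h]

/-- The sign of `b k` multiplies `σ k`, and its modulus is absorbed in the exponent: `|b k| exp(-2π
t_k) = exp(-2π (t_k - log|b k| / 2π))`. -/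
theorem octMap_act {n : ℕ} {C : Matrix (Fin n) (Fin n) ℝ}
    (hC : C ∈ Matrix.orthogonalGroup (Fin n) ℝ) {B : Matrix (Fin n) (Fin n) ℝ} {b : Fin n → ℝ}
    (hB : C⁻¹ * B * C = Matrix.diagonal b) (hb : ∀ k, b k ≠ 0) {τ : Fin n → ℤˣ}
    (hτ : ∀ k, Real.sign (b k) = ((τ k : ℤ) : ℝ)) (σ : Fin n → ℤˣ) (t : Rn n) :
    act B (octMap C σ t) =
      octMap C (σ * τ) (t - WithLp.toLp 2 fun k => Real.log |b k| / (2 * Real.pi)) := by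
  have hpi := Real.pi_pos
  have hdet : IsUnit C.det := isUnit_iff_ne_zero.2 fun h => by
    simpa [h] using abs_det_orthogonal hC
  have hBC : B * C = C * Matrix.diagonal b := by
    rw [← hB, Matrix.mul_assoc, Matrix.mul_nonsing_inv_cancel_left _ _ hdet]
  rw [octMap, octMap, act_act, hBC, ← act_act]
  congr 1
  ext k
  have hexp : Real.exp (-(2 * Real.pi * (t k - Real.log |b k| / (2 * Real.pi)))) =
      |b k| * Real.exp (-(2 * Real.pi * t k)) := by
    rw [← Real.exp_log (abs_pos.2 (hb k)), ← Real.exp_add, Real.exp_log (abs_pos.2 (hb k))]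
    congr 1
    field_simp
    ring
  have hbk : b k = ((τ k : ℤ) : ℝ) * |b k| := by
    rw [← hτ]
    rcases lt_or_gt_of_ne (hb k) with h | h
    · simp [Real.sign_of_neg h, abs_of_neg h]
    · simp [Real.sign_of_pos h, abs_of_pos h]
  simp only [act, Matrix.mulVec_diagonal, expPi, WithLp.ofLp_sub, Pi.sub_apply, hexp, Pi.mul_apply,
    Units.val_mul, Int.cast_mul]
  conv_lhs => rw [hbk]
  ring

theorem octWeight_sub {n : ℕ} (b : Fin n → ℝ) (t : Rn n) :
    octWeight t = (∏ k, Real.exp (-(1 / 2) * Real.log |b k|)) *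
      octWeight (t - WithLp.toLp 2 fun k => Real.log |b k| / (2 * Real.pi)) := by
  have hpi := Real.pi_pos
  rw [octWeight, octWeight, ← Finset.prod_mul_distrib]
  refine Finset.prod_congr rfl fun k _ => ?_
  rw [mul_left_comm, ← Real.exp_add]
  congr 2
  simp only [PiLp.sub_apply]
  field_simp
  ring

/-- The two factors have different origins: the character comes from the Fourier transform of a
translation, the modulus from the weight (`octWeight_sub`). -/
theorem absPow_eq {n : ℕ} (b : Fin n → ℝ) (s : Rn n) :
    absPow b s = Complex.exp (-(2 * Real.pi * inner ℝ
        (WithLp.toLp 2 fun k => Real.log |b k| / (2 * Real.pi) : Rn n) s : ℝ) * Complex.I) *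
      ((∏ k, Real.exp (-(1 / 2) * Real.log |b k|) : ℝ) : ℂ) := by
  have hpi : (Real.pi : ℂ) ≠ 0 := Complex.ofReal_ne_zero.2 Real.pi_pos.ne'
  rw [absPow, ← Complex.exp_sum, ← Real.exp_sum, Complex.ofReal_exp, ← Complex.exp_add]
  congr 1
  simp only [PiLp.inner_apply, RCLike.inner_apply, conj_trivial]
  push_cast
  rw [Finset.mul_sum, ← Finset.sum_neg_distrib, Finset.sum_mul, ← Finset.sum_add_distrib]
  refine Finset.sum_congr rfl fun k _ => ?_
  field_simp
  ring

/-- Before the Fourier transform, component `i` of `f ∘ B` is a scalar times a translate of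
component `j` of `f`, where `e j = e i * τ`. Hence a constant matrix with one nonzero entry per row
acts on a translate, and `fourier_translate` applies. -/
theorem mellin_comp_act {n : ℕ} {C : Matrix (Fin n) (Fin n) ℝ}
    (hC : C ∈ Matrix.orthogonalGroup (Fin n) ℝ) (e : Fin (2 ^ n) ≃ (Fin n → ℤˣ))
    {B : Matrix (Fin n) (Fin n) ℝ} {b : Fin n → ℝ} (hB : C⁻¹ * B * C = Matrix.diagonal b)
    (hb : ∀ k, b k ≠ 0) (f g : L2 n) (hg : ∀ᵐ x, g x = f (act B x)) :
    ∀ᵐ s, mellin hC e g s = WithLp.toLp 2 (dilationMatrix e b s *ᵥ (mellin hC e f s).ofLp) := by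
  classical
  obtain ⟨τ, hτ⟩ := exists_units_sign hb
  let l : Rn n := WithLp.toLp 2 fun k => Real.log |b k| / (2 * Real.pi)
  let P : Matrix (Fin (2 ^ n)) (Fin (2 ^ n)) ℂ := Matrix.of fun i j =>
    if ∀ k, Real.sign (b k) = ((signChange e i j k : ℤ) : ℝ) then
      ((∏ k, Real.exp (-(1 / 2) * Real.log |b k|) : ℝ) : ℂ) else 0
  have hP : ∀ s : Rn n, Complex.exp (-(2 * Real.pi * inner ℝ l s : ℝ) * Complex.I) • P =
      dilationMatrix e b s := fun s => by
    ext i j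
    simp only [P, dilationMatrix, Matrix.smul_apply, Matrix.of_apply, smul_eq_mul, mul_ite,
      mul_zero, absPow_eq, l]
  have hmp : MeasurePreserving (fun t : Rn n => t - l) volume volume :=
    measurePreserving_sub_right _ l
  have key := fourier_translate P l (octIsometry hC e f) (octIsometry hC e g) (by
    filter_upwards [octIsometry_ae hC e g, octComponents_congr hC e hg,
      hmp.quasiMeasurePreserving.ae (octIsometry_ae hC e f)] with t h1 h2 h3
    rw [h1, h2, h3]
    ext i
    -- Signs square to one, so `ε(i; j) = τ` has exactly one solution `j`.
    have hj : ∀ j, (∀ k, Real.sign (b k) = ((signChange e i j k : ℤ) : ℝ)) ↔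
        j = e.symm (e i * τ) := fun j => by
      rw [Equiv.eq_symm_apply]
      constructor
      · intro h
        funext k
        have hk := (hτ k).symm.trans (h k)
        have hk' : τ k = e i k * e j k := Units.ext (by exact_mod_cast hk)
        rw [Pi.mul_apply, hk', ← mul_assoc, Int.units_mul_self, one_mul]
      · intro h k
        rw [hτ, signChange, h, Pi.mul_apply, Pi.mul_apply, ← mul_assoc, Int.units_mul_self, one_mul]
    simp only [octComponents, Matrix.mulVec, dotProduct, P, Matrix.of_apply, hj, ite_mul, zero_mul,
      Finset.sum_ite_eq', Finset.mem_univ, if_true, Equiv.apply_symm_apply]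
    rw [octMap_act hC hB hb hτ, octWeight_sub b t, Complex.ofReal_mul, mul_assoc])
  filter_upwards [key] with s hs
  rw [← hP]
  exact hs

/-! ### The weak form determines the Hausdorff operator -/

theorem lintegral_enorm_mul_le {α F G : Type*} [MeasurableSpace α] [NormedAddCommGroup F]
    [NormedAddCommGroup G] {ν : Measure α} {f : α → F} {g : α → G}
    (hf : AEStronglyMeasurable f ν) (hg : AEStronglyMeasurable g ν) :
    ∫⁻ x, ‖f x‖ₑ * ‖g x‖ₑ ∂ν ≤ eLpNorm f 2 ν * eLpNorm g 2 ν := by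
  refine (ENNReal.lintegral_mul_le_Lp_mul_Lq ν Real.HolderConjugate.two_two
    hf.enorm hg.enorm).trans (le_of_eq ?_)
  simp only [eLpNorm_eq_lintegral_rpow_enorm_toReal two_ne_zero ENNReal.ofNat_ne_top,
    ENNReal.toReal_ofNat]

theorem eLpNorm_comp_act {n : ℕ} {B : Matrix (Fin n) (Fin n) ℝ} (hB : B.det ≠ 0)
    {f : Rn n → ℂ} (hf : Measurable f) :
    eLpNorm (fun x => f (act B x)) 2 volume =
      ENNReal.ofReal (|B.det| ^ (-(1 / 2) : ℝ)) * eLpNorm f 2 volume := by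
  refine (ENNReal.pow_right_strictMono two_ne_zero).injective ?_
  have hpos : 0 < |B.det| := abs_pos.2 hB
  beta_reduce
  rw [mul_pow, eLpNorm_two_sq, eLpNorm_two_sq, ← ENNReal.ofReal_pow (by positivity),
    ← Real.rpow_natCast, ← Real.rpow_mul hpos.le]
  have h := lintegral_comp_act hB (hf.enorm.pow_const 2)
  rw [h, abs_inv, ← Real.rpow_neg_one]
  norm_num

/-- The hypotheses on the kernel and the matrices under which the Hausdorff operator is bounded. -/
structure Admissible {Ω : Type*} [MeasurableSpace Ω] (μ : Measure Ω) {n : ℕ} (K : Ω → ℂ)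
    (A : Ω → Matrix (Fin n) (Fin n) ℝ) : Prop where
  aemeasurable_entry : ∀ k l, AEMeasurable (fun u => A u k l) μ
  det_ne_zero : ∀ᵐ u ∂μ, K u ≠ 0 → (A u).det ≠ 0
  integrable : Integrable (fun u => ((|(A u).det| ^ (-(1 / 2) : ℝ) : ℝ) : ℂ) * K u) μ

namespace Admissible

variable {Ω : Type*} [MeasurableSpace Ω] {μ : Measure Ω} {n : ℕ} {K : Ω → ℂ}
  {A : Ω → Matrix (Fin n) (Fin n) ℝ} (h : Admissible μ K A)

include h

theorem aemeasurable_det : AEMeasurable (fun u => (A u).det) μ := by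
  simp only [Matrix.det_apply']
  exact Finset.aemeasurable_fun_sum _ fun σ _ =>
    (Finset.aemeasurable_fun_prod _ fun i _ => h.aemeasurable_entry _ _).const_mul _

/-- Multiplying the integrable function by `|det A|^{1/2}` gives back `K` almost everywhere, since
`K` vanishes almost everywhere on the set where `A` is singular. -/
theorem aemeasurable_kernel : AEMeasurable K μ := by
  have h1 : AEMeasurable (fun u => ((|(A u).det| ^ (1 / 2 : ℝ) : ℝ) : ℂ) *
      (((|(A u).det| ^ (-(1 / 2) : ℝ) : ℝ) : ℂ) * K u)) μ := by
    refine AEMeasurable.mul ?_ h.integrable.aemeasurable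
    have := h.aemeasurable_det
    exact Complex.measurable_ofReal.comp_aemeasurable
      ((measurable_norm.comp_aemeasurable this).pow_const (1 / 2 : ℝ))
  refine h1.congr ?_
  filter_upwards [h.det_ne_zero] with u hu
  by_cases hK : K u = 0
  · simp [hK]
  · rw [← mul_assoc, ← Complex.ofReal_mul, ← Real.rpow_add (abs_pos.2 (hu hK))]
    simp

theorem aemeasurable_comp {f : Rn n → ℂ} (hf : Measurable f) :
    AEMeasurable (fun p : Ω × Rn n => f (act (A p.1) p.2)) (μ.prod volume) := by
  refine hf.comp_aemeasurable ((PiLp.continuous_toLp 2 _).measurable.comp_aemeasurable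
    (aemeasurable_pi_lambda _ fun i => ?_))
  simp only [Matrix.mulVec, dotProduct]
  refine Finset.aemeasurable_fun_sum _ fun j _ => ((h.aemeasurable_entry i j).comp_fst).mul ?_
  exact (((continuous_apply j).comp (PiLp.continuous_ofLp 2 _)).measurable.comp
    measurable_snd).aemeasurable

/-- Cauchy–Schwarz in `x` bounds the inner integral by `|K(u)| |det A(u)|^{-1/2} ‖g‖ ‖f‖`, which is
integrable in `u`. This licenses Fubini's theorem below. -/
theorem integrable_inner [SFinite μ] (g f : L2 n) :
    Integrable (fun p : Ω × Rn n => K p.1 * inner ℂ (g p.2) (f (act (A p.1) p.2)))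
      (μ.prod volume) := by
  have hg := (Lp.stronglyMeasurable g).measurable
  have hf := (Lp.stronglyMeasurable f).measurable
  have hm : AEMeasurable (fun p : Ω × Rn n => K p.1 * inner ℂ (g p.2) (f (act (A p.1) p.2)))
      (μ.prod volume) :=
    h.aemeasurable_kernel.comp_fst.mul
      ((hg.comp measurable_snd).aemeasurable.inner (h.aemeasurable_comp hf))
  refine ⟨hm.aestronglyMeasurable, ?_⟩
  rw [hasFiniteIntegral_iff_enorm, lintegral_prod _ hm.enorm]
  have hle : ∀ᵐ u ∂μ, ∫⁻ x, ‖K u * inner ℂ (g x) (f (act (A u) x))‖ₑ ≤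
      ‖((|(A u).det| ^ (-(1 / 2) : ℝ) : ℝ) : ℂ) * K u‖ₑ *
        (eLpNorm g 2 volume * eLpNorm f 2 volume) := by
    filter_upwards [h.det_ne_zero] with u hu
    by_cases hK : K u = 0
    · simp [hK]
    have hdet := hu hK
    have hfm := hf.comp (continuous_act (A u)).measurable
    have h1 := lintegral_enorm_mul_le (ν := (volume : Measure (Rn n))) (f := g)
      (g := fun x => f (act (A u) x)) hg.aestronglyMeasurable hfm.aestronglyMeasurable
    rw [eLpNorm_comp_act hdet hf] at h1
    calc ∫⁻ x, ‖K u * inner ℂ (g x) (f (act (A u) x))‖ₑ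
        = ‖K u‖ₑ * ∫⁻ x, ‖g x‖ₑ * ‖f (act (A u) x)‖ₑ := by
          rw [← lintegral_const_mul (f := fun x => ‖g x‖ₑ * ‖f (act (A u) x)‖ₑ) _
            (hg.enorm.mul hfm.enorm)]
          refine lintegral_congr fun x => ?_
          rw [enorm_mul, RCLike.inner_apply, enorm_mul, RCLike.enorm_conj, mul_comm ‖f _‖ₑ]
      _ ≤ ‖K u‖ₑ * (eLpNorm g 2 volume *
          (ENNReal.ofReal (|(A u).det| ^ (-(1 / 2) : ℝ)) * eLpNorm f 2 volume)) := by gcongr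
      _ = _ := by
          rw [enorm_mul, ← ofReal_norm (((|(A u).det| ^ (-(1 / 2) : ℝ) : ℝ) : ℂ)),
            Complex.norm_real, Real.norm_of_nonneg (by positivity)]
          ring
  refine (lintegral_mono_ae hle).trans_lt ?_
  rw [lintegral_mul_const'' _ h.integrable.aemeasurable.enorm]
  exact ENNReal.mul_lt_top h.integrable.hasFiniteIntegral
    (ENNReal.mul_lt_top (Lp.eLpNorm_lt_top g) (Lp.eLpNorm_lt_top f))

/-- A bounded operator with the weak form of the Hausdorff operator is the Hausdorff operator. -/
theorem isHausdorffOperator [SFinite μ] {H : L2 n →L[ℂ] L2 n}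
    (hH : ∀ g f : L2 n, inner ℂ g (H f) =
      ∫ u, K u * (∫ x, inner ℂ (g x) (f (act (A u) x))) ∂μ) :
    IsHausdorffOperator μ K A H := by
  intro f
  -- Taking the indicator of `S` as `g` localizes the weak form to `S`.
  have hS : ∀ {S : Set (Rn n)} (hS : MeasurableSet S) (hS' : volume S ≠ ⊤), ∀ᵐ x, ∀ u,
      K u * inner ℂ (indicatorConstLp 2 hS hS' (1 : ℂ) x) (f (act (A u) x)) =
        S.indicator (fun x => K u * f (act (A u) x)) x := by
    intro S hS hS'
    filter_upwards [indicatorConstLp_coeFn (p := 2) (hs := hS) (hμs := hS') (c := (1 : ℂ))]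
      with x hx u
    rw [hx]
    by_cases hxS : x ∈ S <;> simp [hxS]
  refine ⟨?_, ?_⟩
  · have : ∀ N : ℕ, ∀ᵐ x : Rn n, x ∈ Metric.ball (0 : Rn n) N →
        Integrable (fun u => K u * f (act (A u) x)) μ := fun N => by
      have hb := measure_ball_lt_top (μ := (volume : Measure (Rn n))) (x := 0) (r := N)
      filter_upwards [(h.integrable_inner (indicatorConstLp 2 measurableSet_ball hb.ne 1)
        f).prod_left_ae, hS measurableSet_ball hb.ne] with x hx hx' hmem
      simp only [hx', Set.indicator_of_mem hmem] at hx
      exact hx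
    filter_upwards [ae_all_iff.2 this] with x hx
    obtain ⟨N, hN⟩ := exists_nat_gt (dist x 0)
    exact hx N hN
  · have hind : ∀ {S : Set (Rn n)} (hSm : MeasurableSet S) (hS' : volume S ≠ ⊤),
        (fun x => ∫ u, K u * inner ℂ (indicatorConstLp 2 hSm hS' (1 : ℂ) x) (f (act (A u) x)) ∂μ)
          =ᵐ[volume] S.indicator (fun x => ∫ u, K u * f (act (A u) x) ∂μ) := by
      intro S hSm hS'
      filter_upwards [hS hSm hS'] with x hx
      simp only [hx]
      by_cases hxS : x ∈ S <;> simp [hxS]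
    -- Equality of the integrals over all sets of finite measure suffices; it is the weak form for
    -- indicators combined with Fubini.
    refine ae_eq_of_forall_setIntegral_eq_of_sigmaFinite (fun S hSm hS' => ?_)
      (fun S hSm hS' => ?_) fun S hSm hS' => ?_
    · have : IsFiniteMeasure ((volume : Measure (Rn n)).restrict S) := ⟨by simpa using hS'⟩
      exact ((Lp.memLp (H f)).restrict S).integrable (by norm_num)
    · rw [← integrable_indicator_iff hSm]
      exact (h.integrable_inner (indicatorConstLp 2 hSm hS'.ne 1) f).integral_prod_right.congr
        (hind hSm hS'.ne)
    · rw [← L2.inner_indicatorConstLp_one hSm hS'.ne, hH, ← integral_indicator hSm,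
        ← integral_congr_ae (hind hSm hS'.ne), ← integral_integral_swap
          (h.integrable_inner (indicatorConstLp 2 hSm hS'.ne 1) f)]
      simp only [integral_const_mul]

end Admissible

/-! ### The symbol as an average of dilation matrices -/

theorem norm_absPow {n : ℕ} (b : Fin n → ℝ) (hb : ∀ k, b k ≠ 0) (s : Rn n) :
    ‖absPow b s‖ = |∏ k, b k| ^ (-(1 / 2) : ℝ) := by
  rw [absPow, norm_prod, Finset.abs_prod, ← Real.finsetProd_rpow _ _ fun k _ => abs_nonneg _]
  refine Finset.prod_congr rfl fun k _ => ?_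
  rw [Complex.norm_exp, Real.rpow_def_of_pos (abs_pos.2 (hb k))]
  congr 1
  simp [mul_comm]

theorem norm_dilationMatrix_le {n : ℕ} (e : Fin (2 ^ n) ≃ (Fin n → ℤˣ)) (b : Fin n → ℝ)
    (hb : ∀ k, b k ≠ 0) (s : Rn n) (i j : Fin (2 ^ n)) :
    ‖dilationMatrix e b s i j‖ ≤ |∏ k, b k| ^ (-(1 / 2) : ℝ) := by
  rw [dilationMatrix, Matrix.of_apply]
  split_ifs
  · exact (norm_absPow b hb s).le
  · rw [norm_zero]
    positivity

theorem measurable_real_sign : Measurable Real.sign := by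
  unfold Real.sign
  exact Measurable.ite (measurableSet_lt measurable_id measurable_const) measurable_const
    (Measurable.ite (measurableSet_lt measurable_const measurable_id) measurable_const
      measurable_const)

theorem measurable_absPow {n : ℕ} : Measurable fun q : (Fin n → ℝ) × Rn n => absPow q.1 q.2 := by
  unfold absPow
  have h : ∀ k, Measurable fun q : (Fin n → ℝ) × Rn n => q.2 k := fun k => by fun_prop
  refine Finset.measurable_fun_prod _ fun k _ => Complex.measurable_exp.comp (Measurable.mul ?_ ?_)
  · exact measurable_const.sub (measurable_const.mul (Complex.measurable_ofReal.comp (h k)))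
  · exact Complex.measurable_ofReal.comp (Real.measurable_log.comp
      ((measurable_pi_apply k).comp measurable_fst).abs)

theorem measurable_dilationMatrix {n : ℕ} (e : Fin (2 ^ n) ≃ (Fin n → ℤˣ)) (i j : Fin (2 ^ n)) :
    Measurable fun q : (Fin n → ℝ) × Rn n => dilationMatrix e q.1 q.2 i j := by
  simp only [dilationMatrix, Matrix.of_apply]
  refine Measurable.ite ?_ measurable_absPow measurable_const
  simp only [Set.ofPred_forall]
  exact MeasurableSet.iInter fun k => measurableSet_eq_fun
    (measurable_real_sign.comp ((measurable_pi_apply k).comp measurable_fst)) measurable_const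

theorem continuous_dilationMatrix {n : ℕ} (e : Fin (2 ^ n) ≃ (Fin n → ℤˣ)) (b : Fin n → ℝ)
    (i j : Fin (2 ^ n)) : Continuous fun s => dilationMatrix e b s i j := by
  simp only [dilationMatrix, Matrix.of_apply]
  split_ifs
  · unfold absPow
    fun_prop
  · exact continuous_const

theorem IsDiagonalizedBy.det_eq {Ω : Type*} {n : ℕ} {A : Ω → Matrix (Fin n) (Fin n) ℝ}
    {C : Matrix (Fin n) (Fin n) ℝ} {a : Ω → Fin n → ℝ} (hd : IsDiagonalizedBy A C a) (u : Ω) :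
    ∏ k, a u k = (A u).det := by
  have hdet : IsUnit C.det := isUnit_iff_ne_zero.2 fun h => by
    simpa [h] using abs_det_orthogonal hd.1
  have h := congrArg Matrix.det (hd.2 u)
  rw [Matrix.det_diagonal, Matrix.det_mul, Matrix.det_mul, Matrix.det_nonsing_inv] at h
  rw [← h, mul_right_comm, Ring.inverse_mul_cancel _ hdet, one_mul]

theorem memLp_comp_act {n : ℕ} {B : Matrix (Fin n) (Fin n) ℝ} (hB : B.det ≠ 0) (f : L2 n) :
    MemLp (fun x => f (act B x)) 2 volume := by
  have hf := (Lp.stronglyMeasurable f).measurable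
  refine ⟨(hf.comp (continuous_act B).measurable).aestronglyMeasurable, ?_⟩
  rw [eLpNorm_comp_act hB hf]
  exact ENNReal.mul_lt_top ENNReal.ofReal_lt_top (Lp.eLpNorm_lt_top f)

namespace Admissible

variable {Ω : Type*} [MeasurableSpace Ω] {μ : Measure Ω} {n : ℕ} {K : Ω → ℂ}
  {A : Ω → Matrix (Fin n) (Fin n) ℝ} (h : Admissible μ K A)
  {C : Matrix (Fin n) (Fin n) ℝ} {a : Ω → Fin n → ℝ} (hd : IsDiagonalizedBy A C a)
  (e : Fin (2 ^ n) ≃ (Fin n → ℤˣ))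

include h hd

theorem aemeasurable_eigenvalues : AEMeasurable a μ := by
  refine aemeasurable_pi_lambda _ fun k => ?_
  have : ∀ u, a u k = (C⁻¹ * A u * C) k k := fun u => by rw [hd.2 u, Matrix.diagonal_apply_eq]
  simp only [this, Matrix.mul_apply]
  exact Finset.aemeasurable_fun_sum _ fun j _ => (Finset.aemeasurable_fun_sum _ fun i _ =>
    (h.aemeasurable_entry i j).const_mul _).mul_const _

theorem eigenvalues_ne_zero : ∀ᵐ u ∂μ, K u ≠ 0 → ∀ k, a u k ≠ 0 := by
  filter_upwards [h.det_ne_zero] with u hu hK k hk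
  refine hu hK ?_
  rw [← hd.det_eq u]
  exact Finset.prod_eq_zero (Finset.mem_univ k) hk

/-- The character in `absPow` is unimodular, so one integrable function dominates for all `s`;
continuity and boundedness of the symbol both follow. -/
theorem norm_kernel_mul_le (i j : Fin (2 ^ n)) :
    ∀ᵐ u ∂μ, ∀ s, ‖K u * dilationMatrix e (a u) s i j‖ ≤
      ‖((|(A u).det| ^ (-(1 / 2) : ℝ) : ℝ) : ℂ) * K u‖ := by
  filter_upwards [h.eigenvalues_ne_zero hd] with u hu s
  by_cases hK : K u = 0
  · simp [hK]
  rw [norm_mul, norm_mul, Complex.norm_real, Real.norm_of_nonneg (by positivity), mul_comm,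
    ← hd.det_eq u]
  gcongr
  exact norm_dilationMatrix_le e _ (hu hK) s i j

theorem aemeasurable_kernel_mul (s : Rn n) (i j : Fin (2 ^ n)) :
    AEMeasurable (fun u => K u * dilationMatrix e (a u) s i j) μ :=
  h.aemeasurable_kernel.mul ((measurable_dilationMatrix e i j).comp_aemeasurable
    ((h.aemeasurable_eigenvalues hd).prodMk aemeasurable_const))

theorem integrable_kernel_mul (s : Rn n) (i j : Fin (2 ^ n)) :
    Integrable (fun u => K u * dilationMatrix e (a u) s i j) μ := by
  refine h.integrable.mono (h.aemeasurable_kernel_mul hd e s i j).aestronglyMeasurable ?_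
  filter_upwards [h.norm_kernel_mul_le hd e i j] with u hu using hu s

theorem symbol_apply (s : Rn n) (i j : Fin (2 ^ n)) :
    symbol μ K a e s i j = ∫ u, K u * dilationMatrix e (a u) s i j ∂μ := by
  have hm : NullMeasurableSet (signSet a (signChange e i j)) μ := by
    simp only [signSet, Set.ofPred_forall]
    refine NullMeasurableSet.iInter fun k => ?_
    have h1 : AEMeasurable (fun u => Real.sign (a u k)) μ :=
      (measurable_real_sign.comp (measurable_pi_apply (X := fun _ => ℝ) k)).comp_aemeasurable
        (h.aemeasurable_eigenvalues hd)
    exact h1.nullMeasurable (measurableSet_singleton _)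
  rw [symbol, Matrix.of_apply, ← integral_indicator₀ hm]
  congr 1
  funext u
  simp only [dilationMatrix, Matrix.of_apply, Set.indicator_apply, signSet, Set.mem_ofPred_eq]
  split_ifs <;> simp

theorem continuous_symbol (i j : Fin (2 ^ n)) : Continuous fun s => symbol μ K a e s i j := by
  simp only [h.symbol_apply hd]
  refine continuous_of_dominated
    (fun s => (h.aemeasurable_kernel_mul hd e s i j).aestronglyMeasurable) (fun s => ?_)
    h.integrable.norm (Filter.Eventually.of_forall fun u =>
      continuous_const.mul (continuous_dilationMatrix e _ i j))
  filter_upwards [h.norm_kernel_mul_le hd e i j] with u hu using hu s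

theorem norm_symbol_le (s : Rn n) (i j : Fin (2 ^ n)) : ‖symbol μ K a e s i j‖ ≤
    ∫ u, ‖((|(A u).det| ^ (-(1 / 2) : ℝ) : ℝ) : ℂ) * K u‖ ∂μ := by
  rw [h.symbol_apply hd]
  refine norm_integral_le_of_norm_le h.integrable.norm ?_
  filter_upwards [h.norm_kernel_mul_le hd e i j] with u hu using hu s

theorem exists_isMultiplicationOperator_symbol :
    ∃ M : L2Vec n (2 ^ n) →L[ℂ] L2Vec n (2 ^ n),
      IsMultiplicationOperator (symbol μ K a e) M :=
  exists_isMultiplicationOperator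
    (fun i j => (h.continuous_symbol hd e i j).aestronglyMeasurable)
    (h.norm_symbol_le hd e)

theorem integrable_inner_dilationMatrix [SFinite μ] (F G : L2Vec n (2 ^ n)) :
    Integrable (fun p : Ω × Rn n => K p.1 * inner ℂ (F p.2)
      (WithLp.toLp 2 (dilationMatrix e (a p.1) p.2 *ᵥ (G p.2).ofLp))) (μ.prod volume) := by
  have hF := (Lp.stronglyMeasurable F).measurable
  have hG := (Lp.stronglyMeasurable G).measurable
  have hFG : Integrable (fun s => ‖F s‖ * ‖G s‖) volume :=
    (Lp.memLp F).norm.integrable_mul (Lp.memLp G).norm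
  have hbound := h.integrable.norm.mul_prod
    (hFG.const_mul (((2 ^ n : ℕ) : ℝ) * ((2 ^ n : ℕ) : ℝ)))
  refine hbound.mono ?_ ?_
  · refine h.aemeasurable_kernel.comp_fst.aestronglyMeasurable.mul (AEStronglyMeasurable.inner
      (hF.comp measurable_snd).aestronglyMeasurable
      (aestronglyMeasurable_mulVec (fun i j => ?_) (hG.comp measurable_snd).aestronglyMeasurable))
    exact ((measurable_dilationMatrix e i j).comp_aemeasurable
      ((h.aemeasurable_eigenvalues hd).comp_fst.prodMk
        measurable_snd.aemeasurable)).aestronglyMeasurable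
  · have hae : ∀ᵐ p ∂(μ.prod (volume : Measure (Rn n))), K p.1 ≠ 0 → ∀ k, a p.1 k ≠ 0 :=
      Measure.quasiMeasurePreserving_fst.ae (h.eigenvalues_ne_zero hd)
    filter_upwards [hae] with p hp
    by_cases hK : K p.1 = 0
    · simp [hK]
    have h1 := norm_toLp_mulVec_le (norm_dilationMatrix_le e _ (hp hK) p.2) (G p.2)
    rw [hd.det_eq] at h1
    have h2 := norm_inner_le_norm (𝕜 := ℂ) (F p.2)
      (WithLp.toLp 2 (dilationMatrix e (a p.1) p.2 *ᵥ (G p.2).ofLp))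
    rw [norm_mul, norm_mul, norm_norm, norm_mul, Complex.norm_real,
      Real.norm_of_nonneg (by positivity : (0 : ℝ) ≤ |(A p.1).det| ^ (-(1 / 2) : ℝ)),
      Real.norm_of_nonneg (by positivity)]
    calc _ ≤ ‖K p.1‖ * (‖F p.2‖ * ((2 ^ n : ℕ) * ((2 ^ n : ℕ) *
          |(A p.1).det| ^ (-(1 / 2) : ℝ)) * ‖G p.2‖)) := by
          gcongr
          exact h2.trans (by gcongr)
      _ = _ := by ring

theorem integral_inner_dilationMatrix (s : Rn n) (v w : EuclideanSpace ℂ (Fin (2 ^ n))) :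
    ∫ u, K u * inner ℂ v (WithLp.toLp 2 (dilationMatrix e (a u) s *ᵥ w.ofLp)) ∂μ =
      inner ℂ v (WithLp.toLp 2 (symbol μ K a e s *ᵥ w.ofLp)) := by
  have h1 : ∀ P : Matrix (Fin (2 ^ n)) (Fin (2 ^ n)) ℂ,
      inner ℂ v (WithLp.toLp 2 (P *ᵥ w.ofLp)) =
        ∑ i, ∑ j, P i j * (w j * (starRingEnd ℂ) (v i)) := fun P => by
    simp only [PiLp.inner_apply, RCLike.inner_apply, Matrix.mulVec, dotProduct, Finset.sum_mul,
      mul_assoc]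
  simp only [h1, Finset.mul_sum, ← mul_assoc (K _)]
  rw [integral_finsetSum]
  · refine Finset.sum_congr rfl fun i _ => ?_
    rw [integral_finsetSum]
    · refine Finset.sum_congr rfl fun j _ => ?_
      rw [integral_mul_const, h.symbol_apply hd]
    · exact fun j _ => (h.integrable_kernel_mul hd e s i j).mul_const _
  · exact fun i _ => integrable_finsetSum _ fun j _ =>
      (h.integrable_kernel_mul hd e s i j).mul_const _

/-- Unitarity of `mellin` and `mellin_comp_act` rewrite the inner integral for each `u`; Fubini then
moves the `u`-integral inside, where it produces the symbol. -/
theorem weak_form [SFinite μ] {M : L2Vec n (2 ^ n) →L[ℂ] L2Vec n (2 ^ n)}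
    (hM : IsMultiplicationOperator (symbol μ K a e) M) (g f : L2 n) :
    inner ℂ (mellin hd.1 e g) (M (mellin hd.1 e f)) =
      ∫ u, K u * (∫ x, inner ℂ (g x) (f (act (A u) x))) ∂μ := by
  have h1 : ∀ᵐ u ∂μ, K u * (∫ x, inner ℂ (g x) (f (act (A u) x))) =
      ∫ s, K u * inner ℂ (mellin hd.1 e g s)
        (WithLp.toLp 2 (dilationMatrix e (a u) s *ᵥ (mellin hd.1 e f s).ofLp)) := by
    filter_upwards [h.det_ne_zero, h.eigenvalues_ne_zero hd] with u hu hu'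
    by_cases hK : K u = 0
    · simp [hK]
    have hLp := memLp_comp_act (hu hK) f
    have h2 : ∫ x, inner ℂ (g x) (f (act (A u) x)) = inner ℂ g (hLp.toLp _) := by
      rw [L2.inner_def]
      refine integral_congr_ae ?_
      filter_upwards [hLp.coeFn_toLp] with x hx
      rw [hx]
    rw [integral_const_mul, h2, ← (mellin hd.1 e).inner_map_map, L2.inner_def]
    congr 1
    refine integral_congr_ae ?_
    filter_upwards [mellin_comp_act hd.1 e (hd.2 u) (hu' hK) f _ hLp.coeFn_toLp] with s hs
    rw [hs]
  rw [integral_congr_ae h1, integral_integral_swap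
    (h.integrable_inner_dilationMatrix hd e (mellin hd.1 e g) (mellin hd.1 e f)), L2.inner_def]
  refine integral_congr_ae ?_
  filter_upwards [hM (mellin hd.1 e f)] with s hs
  rw [h.integral_inner_dilationMatrix hd, hs]

end Admissible

/-! ### Simultaneous diagonalization -/

theorem exists_orthonormalBasis_mem_of_fintype {n : ℕ} {F : Type*} [NormedAddCommGroup F]
    [InnerProductSpace ℝ F] [FiniteDimensional ℝ F] (hn : Module.finrank ℝ F = n)
    {ι : Type*} [DecidableEq ι] [Fintype ι] {E : ι → Submodule ℝ F}
    (hint : DirectSum.IsInternal E)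
    (horth : OrthogonalFamily ℝ (fun χ => E χ) fun χ => (E χ).subtypeₗᵢ) :
    ∃ (b : OrthonormalBasis (Fin n) ℝ F) (χ : Fin n → ι), ∀ k, b k ∈ E (χ k) :=
  ⟨hint.subordinateOrthonormalBasis hn horth,
    fun k => hint.subordinateOrthonormalBasisIndex hn k horth,
    fun k => hint.subordinateOrthonormalBasis_subordinate hn k horth⟩

/-- The index type may be infinite, but independent subspaces of a finite-dimensional space are
nonzero only for finitely many indices, and the zero ones can be dropped. -/
theorem exists_orthonormalBasis_mem {n : ℕ} {ι : Type*} [DecidableEq ι]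
    {E : ι → Submodule ℝ (Rn n)} (hint : DirectSum.IsInternal E)
    (horth : OrthogonalFamily ℝ (fun χ => E χ) fun χ => (E χ).subtypeₗᵢ) :
    ∃ (b : OrthonormalBasis (Fin n) ℝ (Rn n)) (χ : Fin n → ι), ∀ k, b k ∈ E (χ k) := by
  classical
  have hfin : {χ | E χ ≠ ⊥}.Finite :=
    WellFoundedGT.finite_ne_bot_of_iSupIndep hint.submodule_iSupIndep
  have : Fintype {χ // E χ ≠ ⊥} := hfin.fintype
  obtain ⟨b, χ, hb⟩ := exists_orthonormalBasis_mem_of_fintype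
    finrank_euclideanSpace_fin (DirectSum.isInternal_ne_bot_iff.2 hint) (horth.comp Subtype.val_injective)
  exact ⟨b, fun k => χ k, hb⟩

theorem exists_isDiagonalizedBy {Ω : Type*} {n : ℕ} {A : Ω → Matrix (Fin n) (Fin n) ℝ}
    (hA : ∀ u, (A u).IsHermitian) (hAA : ∀ u v, Commute (A u) (A v)) :
    ∃ (C : Matrix (Fin n) (Fin n) ℝ) (a : Ω → Fin n → ℝ), IsDiagonalizedBy A C a := by
  classical
  let T : Ω → Rn n →ₗ[ℝ] Rn n := fun u => Matrix.toEuclideanLin (A u)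
  have hT : ∀ u x, T u x = WithLp.toLp 2 (A u *ᵥ x.ofLp) := fun u x => rfl
  have hsymm : ∀ u, (T u).IsSymmetric := fun u => Matrix.isSymmetric_toEuclideanLin_iff.2 (hA u)
  have hcomm : Pairwise (Function.onFun Commute T) := fun u v _ => by
    refine LinearMap.ext fun x => ?_
    simp only [Module.End.mul_apply, hT, Matrix.mulVec_mulVec, (hAA u v).eq]
  -- Joint eigenspaces: `χ` prescribes an eigenvalue for every `u` at once. The columns of `C` are
  -- to be unit vectors in them.
  let E : (Ω → ℝ) → Submodule ℝ (Rn n) := fun χ => ⨅ u, Module.End.eigenspace (T u) (χ u)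
  have hint : DirectSum.IsInternal E :=
    LinearMap.IsSymmetric.directSum_isInternal_of_pairwise_commute hsymm hcomm
  have horth : OrthogonalFamily ℝ (fun χ => E χ) fun χ => (E χ).subtypeₗᵢ :=
    LinearMap.IsSymmetric.orthogonalFamily_iInf_eigenspaces hsymm
  obtain ⟨b, χ, hbχ⟩ := exists_orthonormalBasis_mem hint horth
  have hb : ∀ k u, A u *ᵥ (b k).ofLp = χ k u • (b k).ofLp := fun k u =>
    congrArg WithLp.ofLp
      (Module.End.mem_eigenspace_iff.1 ((Submodule.mem_iInf _).1 (hbχ k) u))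
  let C : Matrix (Fin n) (Fin n) ℝ := Matrix.of fun i k => b k i
  have hC : Cᵀ * C = 1 := by
    ext i j
    have h1 := b.inner_eq_ite i j
    rw [PiLp.inner_apply] at h1
    rw [Matrix.mul_apply, Matrix.one_apply, ← h1]
    refine Finset.sum_congr rfl fun k _ => ?_
    simp [C, mul_comm]
  have hCo : C ∈ Matrix.orthogonalGroup (Fin n) ℝ := (Matrix.mem_orthogonalGroup_iff' _ _).2 hC
  refine ⟨C, fun u k => χ k u, hCo, fun u => ?_⟩
  have hdet : IsUnit C.det := isUnit_iff_ne_zero.2 fun h => by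
    simpa [h] using abs_det_orthogonal hCo
  have hAC : A u * C = C * Matrix.diagonal fun k => χ k u := by
    ext i k
    have := congrFun (hb k u) i
    rw [Matrix.mul_diagonal]
    simpa [Matrix.mul_apply, Matrix.mulVec, dotProduct, C, mul_comm] using this
  rw [Matrix.mul_assoc, hAC, Matrix.nonsing_inv_mul_cancel_left _ _ hdet]

/-! ### Invertibility of multiplication operators -/

theorem norm_det_le {m : ℕ} {P : Matrix (Fin m) (Fin m) ℂ} {B : ℝ} (hB : ∀ i j, ‖P i j‖ ≤ B) :
    ‖P.det‖ ≤ m.factorial * B ^ m := by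
  have := Matrix.det_le (abv := IsAbsoluteValue.toAbsoluteValue (norm : ℂ → ℝ)) (A := P) (x := B) hB
  simpa using this

theorem exists_bound_adjugate {m : ℕ} (B : ℝ) : ∃ D : ℝ, 0 ≤ D ∧
    ∀ P : Matrix (Fin m) (Fin m) ℂ, (∀ i j, ‖P i j‖ ≤ B) → ∀ i j, ‖P.adjugate i j‖ ≤ D := by
  -- An adjugate entry is the determinant of `P` with one row replaced by a unit vector, whence the
  -- maximum with `1`.
  refine ⟨m.factorial * (max B 1) ^ m, by positivity, fun P hP i j => ?_⟩
  rw [Matrix.adjugate_apply]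
  refine norm_det_le fun k l => ?_
  rw [Matrix.updateRow_apply]
  split_ifs
  · rw [Pi.single_apply]
    split_ifs <;> simp
  · exact (hP k l).trans (le_max_left _ _)

theorem exists_isMultiplicationOperator_inv {n m : ℕ} {Ψ : Rn n → Matrix (Fin m) (Fin m) ℂ} {B : ℝ}
    (hΨ : ∀ i j, Continuous fun s => Ψ s i j) (hB : ∀ s i j, ‖Ψ s i j‖ ≤ B)
    (hdet : 0 < ⨅ s, ‖(Ψ s).det‖) :
    ∃ M : L2Vec n m →L[ℂ] L2Vec n m, IsMultiplicationOperator (fun s => (Ψ s)⁻¹) M := by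
  have hc : Continuous Ψ := continuous_matrix hΨ
  have hle : ∀ s, (⨅ s, ‖(Ψ s).det‖) ≤ ‖(Ψ s).det‖ := fun s =>
    ciInf_le ⟨0, by rintro _ ⟨s, rfl⟩; exact norm_nonneg _⟩ s
  have hne : ∀ s, (Ψ s).det ≠ 0 := fun s => norm_pos_iff.1 (hdet.trans_le (hle s))
  have hinv : ∀ s i j, (Ψ s)⁻¹ i j = ((Ψ s).det)⁻¹ * (Ψ s).adjugate i j := fun s i j => by
    rw [Matrix.inv_def, Ring.inverse_eq_inv', Matrix.smul_apply, smul_eq_mul]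
  obtain ⟨D, hD0, hD⟩ := exists_bound_adjugate (m := m) B
  refine exists_isMultiplicationOperator (B := (⨅ s, ‖(Ψ s).det‖)⁻¹ * D) (fun i j => ?_)
    fun s i j => ?_
  · simp only [hinv]
    exact ((hc.matrix_det.inv₀ hne).mul (hc.matrix_adjugate.matrix_elem i j)).aestronglyMeasurable
  · rw [hinv, norm_mul, norm_inv]
    gcongr
    · exact hle s
    · exact hD _ (hB s) i j

/-- A lower bound of a multiplication operator with continuous symbol holds pointwise. -/
theorem IsMultiplicationOperator.le_norm_mulVec {n m : ℕ} {Ψ : Rn n → Matrix (Fin m) (Fin m) ℂ}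
    {M : L2Vec n m →L[ℂ] L2Vec n m} (hM : IsMultiplicationOperator Ψ M)
    (hΨ : ∀ i j, Continuous fun s => Ψ s i j) {c : ℝ} (hc : ∀ g, c * ‖g‖ ≤ ‖M g‖)
    (s : Rn n) (v : EuclideanSpace ℂ (Fin m)) :
    c * ‖v‖ ≤ ‖(WithLp.toLp 2 (Ψ s *ᵥ v.ofLp) : EuclideanSpace ℂ (Fin m))‖ := by
  by_contra! hlt
  have hcont : Continuous fun s =>
      ‖(WithLp.toLp 2 (Ψ s *ᵥ v.ofLp) : EuclideanSpace ℂ (Fin m))‖ :=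
    ((PiLp.continuous_toLp 2 _).comp
      ((continuous_matrix hΨ).matrix_mulVec continuous_const)).norm
  have hv : 0 < ‖v‖ := norm_pos_iff.2 fun h => by simp [h] at hlt
  -- If the bound fails at `s`, continuity makes it fail on a ball with a margin `r`; then `v` times
  -- the indicator of the ball violates the bound for `M`.
  obtain ⟨r, hr1, hr2⟩ := exists_between hlt
  obtain ⟨δ, hδ, hball⟩ := Metric.eventually_nhds_iff_ball.1
    (hcont.continuousAt.eventually_lt continuousAt_const hr1)
  have hfin := (measure_ball_lt_top (μ := (volume : Measure (Rn n))) (x := s) (r := δ)).ne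
  let g : L2Vec n m := indicatorConstLp 2 measurableSet_ball hfin v
  have hg : 0 < ‖g‖ := by
    rw [norm_indicatorConstLp two_ne_zero ENNReal.ofNat_ne_top]
    refine mul_pos hv (Real.rpow_pos_of_pos ?_ _)
    exact ENNReal.toReal_pos (Metric.measure_ball_pos _ _ hδ).ne' hfin
  have hMg : ‖M g‖ ≤ (r / ‖v‖) * ‖g‖ := by
    refine Lp.norm_le_mul_norm_of_ae_le_mul ?_
    filter_upwards [hM g, indicatorConstLp_coeFn (p := 2) (hs := measurableSet_ball) (hμs := hfin)
      (c := v)] with x hx hx'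
    have hx'' : g x = (Metric.ball s δ).indicator (fun _ => v) x := hx'
    rw [hx, hx'']
    by_cases hmem : x ∈ Metric.ball s δ
    · rw [Set.indicator_of_mem hmem, div_mul_cancel₀ _ hv.ne']
      exact (hball x hmem).le
    · simp [Set.indicator_of_notMem hmem]
  have h1 := le_of_mul_le_mul_right ((hc g).trans hMg) hg
  rw [le_div_iff₀ hv] at h1
  linarith

/-- The lower bound excludes a kernel and bounds each column of `P⁻¹` by `c⁻¹`, so that `|det P⁻¹| ≤
m! c⁻ᵐ`. -/
theorem le_norm_det {m : ℕ} {P : Matrix (Fin m) (Fin m) ℂ} {c : ℝ} (hc : 0 < c)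
    (h : ∀ v : EuclideanSpace ℂ (Fin m), c * ‖v‖ ≤
      ‖(WithLp.toLp 2 (P *ᵥ v.ofLp) : EuclideanSpace ℂ (Fin m))‖) :
    ((m.factorial : ℝ) * c⁻¹ ^ m)⁻¹ ≤ ‖P.det‖ := by
  have hdet : IsUnit P.det := by
    rw [isUnit_iff_ne_zero]
    intro h0
    obtain ⟨v, hv, hPv⟩ := Matrix.exists_mulVec_eq_zero_iff.2 h0
    have h1 := h (WithLp.toLp 2 v)
    rw [hPv, WithLp.toLp_zero, norm_zero] at h1
    have h2 : 0 < ‖(WithLp.toLp 2 v : EuclideanSpace ℂ (Fin m))‖ :=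
      norm_pos_iff.2 fun h => hv ((WithLp.toLp_eq_zero 2).1 h)
    nlinarith
  have hentry : ∀ i j, ‖P⁻¹ i j‖ ≤ c⁻¹ := fun i j => by
    have h1 := h (WithLp.toLp 2 (P⁻¹ *ᵥ Pi.single j 1))
    rw [Matrix.mulVec_mulVec, Matrix.mul_nonsing_inv _ hdet, Matrix.one_mulVec] at h1
    have h2 : ‖(WithLp.toLp 2 (Pi.single j 1) : EuclideanSpace ℂ (Fin m))‖ = 1 := by
      rw [PiLp.toLp_single, PiLp.norm_single, norm_one]
    have h3 := PiLp.norm_apply_le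
      (WithLp.toLp 2 (P⁻¹ *ᵥ Pi.single j 1) : EuclideanSpace ℂ (Fin m)) i
    simp only [Matrix.mulVec_single_one, Matrix.col_apply] at h1 h3
    rw [h2] at h1
    refine h3.trans ?_
    rw [← one_div c, le_div_iff₀ hc, mul_comm]
    exact h1
  have h1 := norm_det_le hentry
  have h2 : ‖P⁻¹.det‖ * ‖P.det‖ = 1 := by
    rw [← norm_mul, ← Matrix.det_mul, Matrix.nonsing_inv_mul _ hdet, Matrix.det_one, norm_one]
  have hpos : 0 < (m.factorial : ℝ) * c⁻¹ ^ m := by positivity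
  rw [inv_le_iff_one_le_mul₀ hpos, ← h2, mul_comm]
  gcongr

theorem IsMultiplicationOperator.iInf_norm_det_pos {n m : ℕ}
    {Ψ : Rn n → Matrix (Fin m) (Fin m) ℂ}
    {M : L2Vec n m →L[ℂ] L2Vec n m} (hM : IsMultiplicationOperator Ψ M)
    (hΨ : ∀ i j, Continuous fun s => Ψ s i j) {N : L2Vec n m →L[ℂ] L2Vec n m} (hN : N * M = 1) :
    0 < ⨅ s, ‖(Ψ s).det‖ := by
  -- The summand `1` avoids a separate case `‖N‖ = 0`.
  have hc : 0 < (‖N‖ + 1)⁻¹ := by positivity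
  have hlow : ∀ g, (‖N‖ + 1)⁻¹ * ‖g‖ ≤ ‖M g‖ := fun g => by
    have h1 : N (M g) = g := DFunLike.congr_fun hN g
    have h2 := N.le_opNorm (M g)
    rw [h1] at h2
    rw [inv_mul_le_iff₀ (by positivity)]
    nlinarith [norm_nonneg (M g)]
  refine lt_of_lt_of_le ?_ (le_ciInf fun s => le_norm_det hc (hM.le_norm_mulVec hΨ hlow s))
  positivity

/-! ### Construction of the operator and conclusion -/

namespace Admissible

variable {Ω : Type*} [MeasurableSpace Ω] {μ : Measure Ω} {n : ℕ} {K : Ω → ℂ}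
  {A : Ω → Matrix (Fin n) (Fin n) ℝ} (h : Admissible μ K A)

include h

/-- The operator is the symbol multiplication pulled back by `mellin` for one arbitrary choice of
eigenbasis and enumeration. -/
theorem exists_weak_form [SFinite μ] (hA : ∀ u, (A u).IsHermitian)
    (hAA : ∀ u v, Commute (A u) (A v)) :
    ∃ H : L2 n →L[ℂ] L2 n, ∀ g f : L2 n, inner ℂ g (H f) =
      ∫ u, K u * (∫ x, inner ℂ (g x) (f (act (A u) x))) ∂μ := by
  obtain ⟨C, a, hd⟩ := exists_isDiagonalizedBy hA hAA
  let e : Fin (2 ^ n) ≃ (Fin n → ℤˣ) := (Fintype.equivFinOfCardEq (by simp)).symm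
  obtain ⟨M, hM⟩ := h.exists_isMultiplicationOperator_symbol hd e
  let V := mellin hd.1 e
  refine ⟨V.symm.toContinuousLinearEquiv.toContinuousLinearMap.comp
    (M.comp V.toContinuousLinearEquiv.toContinuousLinearMap), fun g f => ?_⟩
  rw [← h.weak_form hd e hM, ← V.inner_map_map]
  congr 1
  exact V.apply_symm_apply _

/-- Both sides have the same inner products with the range of `mellin`, which is everything. The
choice of `C`, `a` and `e` is free here, independent of the one used to construct `H`. -/
theorem mellin_apply [SFinite μ] {H : L2 n →L[ℂ] L2 n}
    (hH : ∀ g f : L2 n, inner ℂ g (H f) =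
      ∫ u, K u * (∫ x, inner ℂ (g x) (f (act (A u) x))) ∂μ)
    {C : Matrix (Fin n) (Fin n) ℝ} {a : Ω → Fin n → ℝ} (hd : IsDiagonalizedBy A C a)
    (e : Fin (2 ^ n) ≃ (Fin n → ℤˣ)) {M : L2Vec n (2 ^ n) →L[ℂ] L2Vec n (2 ^ n)}
    (hM : IsMultiplicationOperator (symbol μ K a e) M) (f : L2 n) :
    mellin hd.1 e (H f) = M (mellin hd.1 e f) := by
  refine ext_inner_left ℂ fun g => ?_
  obtain ⟨g, rfl⟩ := (mellin hd.1 e).surjective g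
  rw [h.weak_form hd e hM, LinearIsometryEquiv.inner_map_map, hH]

end Admissible

end Hausdorff

theorem corollary1 {Ω : Type*} [TopologicalSpace Ω] [SigmaCompactSpace Ω] [MeasurableSpace Ω]
    [BorelSpace Ω] (μ : Measure Ω) [μ.Regular] (n : ℕ)
    (K : Ω → ℂ) (hK : LocallyIntegrable K μ)
    (A : Ω → Matrix (Fin n) (Fin n) ℝ)
    (hA_meas : ∀ k l, AEMeasurable (fun u => A u k l) μ)
    (hA_selfAdjoint : ∀ u, (A u).IsHermitian)
    (hA_comm : ∀ u v, Commute (A u) (A v))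
    (hA_nonsing : ∀ᵐ u ∂μ, K u ≠ 0 → (A u).det ≠ 0)
    (hKA : Integrable (fun u => ((|(A u).det| ^ (-(1 / 2) : ℝ) : ℝ) : ℂ) * K u) μ) :
    ∃ H : Hausdorff.L2 n →L[ℂ] Hausdorff.L2 n,
      Hausdorff.IsHausdorffOperator μ K A H ∧
      (∃ (C : Matrix (Fin n) (Fin n) ℝ) (a : Ω → Fin n → ℝ),
        Hausdorff.IsDiagonalizedBy A C a) ∧
      ∀ (C : Matrix (Fin n) (Fin n) ℝ) (a : Ω → Fin n → ℝ)
        (e : Fin (2 ^ n) ≃ (Fin n → ℤˣ)),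
        Hausdorff.IsDiagonalizedBy A C a →
        (IsUnit H ↔ 0 < ⨅ s : Hausdorff.Rn n, ‖(Hausdorff.symbol μ K a e s).det‖) ∧
        (IsUnit H →
          ∃ (G : Hausdorff.L2 n →L[ℂ] Hausdorff.L2 n)
            (M : Hausdorff.L2Vec n (2 ^ n) →L[ℂ] Hausdorff.L2Vec n (2 ^ n)),
            G * H = 1 ∧ H * G = 1 ∧
            Hausdorff.IsMultiplicationOperator
              (fun s => (Hausdorff.symbol μ K a e s)⁻¹) M ∧
            Hausdorff.UnitarilyEquivalent G M) := by
  have h : Hausdorff.Admissible μ K A := ⟨hA_meas, hA_nonsing, hKA⟩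
  -- A regular measure on a σ-compact space is σ-finite, as Fubini's theorem requires.
  obtain ⟨H, hH⟩ := h.exists_weak_form hA_selfAdjoint hA_comm
  refine ⟨H, h.isHausdorffOperator hH, Hausdorff.exists_isDiagonalizedBy hA_selfAdjoint hA_comm,
    fun C a e hd => ?_⟩
  obtain ⟨M, hM⟩ := h.exists_isMultiplicationOperator_symbol hd e
  have hcont := h.continuous_symbol hd e
  let V := Hausdorff.mellin hd.1 e
  let Vc : Hausdorff.L2 n →L[ℂ] Hausdorff.L2Vec n (2 ^ n) :=
    V.toContinuousLinearEquiv.toContinuousLinearMap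
  let Vi : Hausdorff.L2Vec n (2 ^ n) →L[ℂ] Hausdorff.L2 n :=
    V.symm.toContinuousLinearEquiv.toContinuousLinearMap
  have hVH : ∀ f, V (H f) = M (V f) := h.mellin_apply hH hd e hM
  have hHV : ∀ g, H (V.symm g) = V.symm (M g) := fun g => by
    rw [← V.apply_symm_apply g, ← hVH]
    simp
  have hpos : IsUnit H → 0 < ⨅ s, ‖(Hausdorff.symbol μ K a e s).det‖ := by
    rintro ⟨⟨H, G, hHG, hGH⟩, rfl⟩
    -- The inverse of `H`, conjugated by `V`, is a left inverse of `M`.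
    refine hM.iInf_norm_det_pos hcont (N := Vc.comp (G.comp Vi)) ?_
    ext1 g
    change V (G (V.symm (M g))) = g
    rw [← hHV]
    change V ((G * H) (V.symm g)) = g
    rw [hGH]
    exact V.apply_symm_apply g
  have hinv : 0 < (⨅ s, ‖(Hausdorff.symbol μ K a e s).det‖) →
      ∃ N, Hausdorff.IsMultiplicationOperator (fun s => (Hausdorff.symbol μ K a e s)⁻¹) N ∧
        N * M = 1 ∧ M * N = 1 := by
    intro hp
    obtain ⟨N, hN⟩ := Hausdorff.exists_isMultiplicationOperator_inv hcont
      (h.norm_symbol_le hd e) hp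
    have hdet : ∀ s, IsUnit (Hausdorff.symbol μ K a e s).det := fun s =>
      isUnit_iff_ne_zero.2 (norm_pos_iff.1 (hp.trans_le
        (ciInf_le ⟨0, by rintro _ ⟨s, rfl⟩; exact norm_nonneg _⟩ s)))
    exact ⟨N, hN, hN.mul hM fun s => Matrix.nonsing_inv_mul _ (hdet s),
      hM.mul hN fun s => Matrix.mul_nonsing_inv _ (hdet s)⟩
  refine ⟨⟨hpos, fun hp => ?_⟩, fun hu => ?_⟩
  · obtain ⟨N, -, hNM, hMN⟩ := hinv hp
    refine ⟨⟨H, Vi.comp (N.comp Vc), ?_, ?_⟩, rfl⟩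
    · ext1 f
      change H (V.symm (N (V f))) = f
      rw [hHV]
      change V.symm ((M * N) (V f)) = f
      rw [hMN]
      exact V.symm_apply_apply f
    · ext1 f
      change V.symm (N (V (H f))) = f
      rw [hVH]
      change V.symm ((N * M) (V f)) = f
      rw [hNM]
      exact V.symm_apply_apply f
  · obtain ⟨N, hN, hNM, -⟩ := hinv (hpos hu)
    obtain ⟨⟨H, G, hHG, hGH⟩, rfl⟩ := hu
    refine ⟨G, N, hGH, hHG, hN, V, fun f => ?_⟩
    -- The intertwining of the inverses: `V G = N M V G = N V H G = N V`.
    have h1 : N (M (V (G f))) = V (G f) := DFunLike.congr_fun hNM _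
    have h2 : H (G f) = f := DFunLike.congr_fun hHG f
    rw [← h1, ← hVH]
    change N (V (H (G f))) = N (V f)
    rw [h2]
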